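/- Let $\mathcal{C}$ be a unital C$^*$-algebra and $n \in \mathbb{N}$. Let $\mathcal{S}^{\mathcal{C}}(\mathbb{R}^n)$ be the space of smooth functions $f \colon \mathbb{R}^n \to \mathcal{C}$ which, together with all their partial derivatives, decay at infinity more rapidly than the inverse of any polynomial, and let $E_n$ be the Hilbert $\mathcal{C}$-module obtained by completing $\mathcal{S}^{\mathcal{C}}(\mathbb{R}^n)$ with respect to the norm $\|f\|_2 := \left\| \int_{\mathbb{R}^n} f(x)^* f(x) \, dx \right\|_{\mathcal{C}}^{1/2}$, with the $\mathcal{C}$-valued inner product that extends $(f, g) \mapsto \int_{\mathbb{R}^n} f(x)^* g(x) \, dx$ by continuity. Let $\mathcal{L}_{\mathcal{C}}(E_n)$ be the C$^*$-algebra of adjointable operators on $E_n$, with the operator norm. For $a, b \in \mathbb{R}^n$ and $c \in \mathbb{R}$ let $\mathcal{U}_{a,b,c}$ be the unitary operator on $E_n$ which extends by continuity $$\mathcal{U}_{a,b,c}(f)(x) := e^{ic} \, e^{i \langle b, x \rangle} f(x - a), \qquad f \in \mathcal{S}^{\mathcal{C}}(\mathbb{R}^n), \ x \in \mathbb{R}^n.$$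 An operator $A \in \mathcal{L}_{\mathcal{C}}(E_n)$ is called Heisenberg smooth if the map $(a, b, c) \mapsto \mathcal{U}_{a,b,c} \, A \, (\mathcal{U}_{a,b,c})^{-1}$ from $\mathbb{R}^{2n+1}$ to $\mathcal{L}_{\mathcal{C}}(E_n)$ is of class $C^\infty$ for the operator norm. Every Heisenberg smooth operator $A \in \mathcal{L}_{\mathcal{C}}(E_n)$ maps $\mathcal{S}^{\mathcal{C}}(\mathbb{R}^n)$ into $\mathcal{S}^{\mathcal{C}}(\mathbb{R}^n)$. -/

import Mathlib

open scoped SchwartzMap ContDiff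
open MeasureTheory

namespace HeisenbergModule

noncomputable section

/-! ### The pre-Hilbert module of Schwartz functions -/

section Gram

variable {n : ℕ} {C : Type*} [CStarAlgebra C]

/-- The `C`-valued inner product `⟨f, g⟩ = ∫ f(x)^* g(x) dx` of two Schwartz functions. -/
def gram (f g : 𝓢(EuclideanSpace ℝ (Fin n), C)) : C :=
  ∫ x, star (f x) * g x

theorem hasTemperateGrowth_star (f : 𝓢(EuclideanSpace ℝ (Fin n), C)) :
    Function.HasTemperateGrowth (fun x => star (f x)) :=
  (((starL' ℝ : C ≃L[ℝ] C) : C →L[ℝ] C).hasTemperateGrowth).comp f.hasTemperateGrowth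

theorem integrable_gram (f g : 𝓢(EuclideanSpace ℝ (Fin n), C)) :
    Integrable (fun x => star (f x) * g x) :=
  (SchwartzMap.bilinLeftCLM (ContinuousLinearMap.mul ℝ C).flip
    (hasTemperateGrowth_star f) g).integrable

theorem gram_add_right (f g h : 𝓢(EuclideanSpace ℝ (Fin n), C)) :
    gram f (g + h) = gram f g + gram f h := by
  simp only [gram, _root_.add_apply, mul_add]
  exact integral_add (integrable_gram f g) (integrable_gram f h)

theorem gram_smul_right (f g : 𝓢(EuclideanSpace ℝ (Fin n), C)) (z : ℂ) :
    gram f (z • g) = z • gram f g := by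
  simp only [gram, _root_.smul_apply, mul_smul_comm]
  exact integral_smul _ _

theorem star_gram (f g : 𝓢(EuclideanSpace ℝ (Fin n), C)) : star (gram f g) = gram g f := by
  have h := ((starL' ℝ : C ≃L[ℝ] C) : C →L[ℝ] C).integral_comp_comm (integrable_gram f g)
  have h2 : star (gram f g) = ∫ x, star (star (f x) * g x) := h.symm
  rw [h2]
  simp [gram]

/-- Right multiplication of a Schwartz function by an element of `C`. -/
def mulRight (c : C) (f : 𝓢(EuclideanSpace ℝ (Fin n), C)) : 𝓢(EuclideanSpace ℝ (Fin n), C) :=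
  SchwartzMap.postcompCLM ((ContinuousLinearMap.mul ℂ C).flip c) f

theorem gram_mulRight (f g : 𝓢(EuclideanSpace ℝ (Fin n), C)) (c : C) :
    gram f (mulRight c g) = gram f g * c := by
  have h := ((ContinuousLinearMap.mul ℝ C).flip c).integral_comp_comm (integrable_gram f g)
  have h2 : gram f g * c = ∫ x, (star (f x) * g x) * c := h.symm
  rw [h2]
  simp [gram, mulRight, mul_assoc]

theorem gram_self_nonneg [PartialOrder C] [StarOrderedRing C]
    (f : 𝓢(EuclideanSpace ℝ (Fin n), C)) : 0 ≤ gram f f :=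
  integral_nonneg fun x => star_mul_self_nonneg (f x)

theorem gram_self_eq_zero (f : 𝓢(EuclideanSpace ℝ (Fin n), C)) : gram f f = 0 ↔ f = 0 := by
  let _ := CStarAlgebra.spectralOrder C
  let _ := CStarAlgebra.spectralOrderedRing C
  constructor
  · intro h
    have hint := integrable_gram f f
    have key : (fun x => star (f x) * f x) =ᵐ[volume] 0 := by
      refine hint.ae_eq_zero_of_forall_setIntegral_eq_zero fun s hs _ => ?_
      have h1 : 0 ≤ ∫ x in s, star (f x) * f x :=
        integral_nonneg fun x => star_mul_self_nonneg (f x)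
      have h2 : 0 ≤ ∫ x in sᶜ, star (f x) * f x :=
        integral_nonneg fun x => star_mul_self_nonneg (f x)
      have h3 : (∫ x in s, star (f x) * f x) + ∫ x in sᶜ, star (f x) * f x = 0 :=
        (integral_add_compl hs hint).trans h
      refine le_antisymm ?_ h1
      rw [← h3]
      exact le_add_of_nonneg_right h2
    have hcont : Continuous fun x => star (f x) * f x := f.continuous.star.mul f.continuous
    have h0 := (hcont.ae_eq_iff_eq volume continuous_const).1 key
    ext x
    exact CStarRing.star_mul_self_eq_zero_iff (f x) |>.1 (congrFun h0 x)
  · rintro rfl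
    simp [gram]

end Gram

/-- The Schwartz space `𝓢(ℝⁿ, C)` as a type of its own, to be normed by
`‖f‖₂ = ‖∫ f(x)^* f(x) dx‖^(1/2)` instead of carrying its Fréchet topology. -/
def PreE (n : ℕ) (C : Type*) [CStarAlgebra C] : Type _ := 𝓢(EuclideanSpace ℝ (Fin n), C)

section PreE

variable (n : ℕ) (C : Type*) [CStarAlgebra C]

instance : AddCommGroup (PreE n C) :=
  inferInstanceAs (AddCommGroup 𝓢(EuclideanSpace ℝ (Fin n), C))

instance : Module ℂ (PreE n C) :=
  inferInstanceAs (Module ℂ 𝓢(EuclideanSpace ℝ (Fin n), C))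

/-- The identity, as a map from the Schwartz space to its copy `PreE n C`. -/
def toPreE : 𝓢(EuclideanSpace ℝ (Fin n), C) ≃ₗ[ℂ] PreE n C :=
  LinearEquiv.refl ℂ 𝓢(EuclideanSpace ℝ (Fin n), C)

instance : Inner C (PreE n C) := ⟨fun f g => gram f g⟩

instance : Norm (PreE n C) := ⟨fun f => √‖(inner C f f : C)‖⟩

/-- Schwartz functions form a (right) pre-Hilbert `C`-module; Mathlib's class of Hilbert modules
is about left modules, so the right `C`-module is seen as a left module over `Cᵐᵒᵖ`. -/
abbrev preCStarModule [PartialOrder C] [StarOrderedRing C] :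
    letI : SMul Cᵐᵒᵖ (PreE n C) := ⟨fun c f => mulRight c.unop f⟩
    CStarModule Cᵐᵒᵖ (PreE n C) :=
  letI : SMul Cᵐᵒᵖ (PreE n C) := ⟨fun c f => mulRight c.unop f⟩
  { inner := fun f g => MulOpposite.op (gram f g)
    inner_add_right := fun {f g h} => congrArg MulOpposite.op (gram_add_right f g h)
    inner_self_nonneg := fun {f} => gram_self_nonneg f
    inner_self := fun {f} => by
      rw [MulOpposite.op_eq_zero_iff]
      exact gram_self_eq_zero f
    inner_op_smul_right := fun {c f g} => congrArg MulOpposite.op (gram_mulRight f g c.unop)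
    inner_smul_right_complex := fun {z f g} => congrArg MulOpposite.op (gram_smul_right f g z)
    star_inner := fun f g => congrArg MulOpposite.op (star_gram f g)
    norm_eq_sqrt_norm_inner_self := fun _ => rfl }

theorem preE_core : NormedSpace.Core ℂ (PreE n C) :=
  let _ := CStarAlgebra.spectralOrder C
  let _ := CStarAlgebra.spectralOrderedRing C
  let _ : SMul Cᵐᵒᵖ (PreE n C) := ⟨fun c f => mulRight c.unop f⟩
  let _ := preCStarModule n C
  CStarModule.normedSpaceCore Cᵐᵒᵖ

instance : NormedAddCommGroup (PreE n C) := NormedAddCommGroup.ofCore (preE_core n C)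

instance : NormedSpace ℂ (PreE n C) := NormedSpace.ofCore (preE_core n C)

end PreE

theorem continuous_inner_preE (n : ℕ) (C : Type*) [CStarAlgebra C] :
    Continuous fun p : PreE n C × PreE n C => (inner C p.1 p.2 : C) := by
  let _ := CStarAlgebra.spectralOrder C
  let _ := CStarAlgebra.spectralOrderedRing C
  let _ : SMul Cᵐᵒᵖ (PreE n C) := ⟨fun c f => mulRight c.unop f⟩
  let _ := preCStarModule n C
  exact MulOpposite.continuous_unop.comp
    (CStarModule.continuous_inner (A := Cᵐᵒᵖ) (E := PreE n C))

/-! ### The Hilbert module `E_n` -/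

/-- The Hilbert `C`-module `E_n`: the completion of `𝓢(ℝⁿ, C)` for the norm `‖·‖₂`. Its `C`-valued
inner product is the extension by continuity of the one of Schwartz functions. -/
abbrev E (n : ℕ) (C : Type*) [CStarAlgebra C] : Type _ := UniformSpace.Completion (PreE n C)

section E

variable {n : ℕ} {C : Type*} [CStarAlgebra C]

/-- The inclusion of the Schwartz space into `E_n`. -/
def ofSchwartz : 𝓢(EuclideanSpace ℝ (Fin n), C) →ₗ[ℂ] E n C :=
  (UniformSpace.Completion.toComplₗᵢ : PreE n C →ₗᵢ[ℂ] E n C).toLinearMap ∘ₗ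
    (toPreE n C).toLinearMap

theorem denseRange_ofSchwartz :
    DenseRange (ofSchwartz : 𝓢(EuclideanSpace ℝ (Fin n), C) →ₗ[ℂ] E n C) :=
  UniformSpace.Completion.denseRange_coe (α := PreE n C)

theorem ofSchwartz_injective :
    Function.Injective (ofSchwartz : 𝓢(EuclideanSpace ℝ (Fin n), C) →ₗ[ℂ] E n C) :=
  UniformSpace.Completion.coe_injective (PreE n C)

theorem norm_ofSchwartz (f : 𝓢(EuclideanSpace ℝ (Fin n), C)) :
    ‖ofSchwartz f‖ = √‖∫ x, star (f x) * f x‖ :=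
  UniformSpace.Completion.norm_coe (toPreE n C f)

theorem inner_ofSchwartz (f g : 𝓢(EuclideanSpace ℝ (Fin n), C)) :
    inner C (ofSchwartz f) (ofSchwartz g) = ∫ x, star (f x) * g x :=
  (UniformSpace.Completion.isDenseInducing_coe.prodMap
    UniformSpace.Completion.isDenseInducing_coe).extend_eq
      (continuous_inner_preE n C) (toPreE n C f, toPreE n C g)

theorem continuous_inner_E :
    Continuous fun p : E n C × E n C => (inner C p.1 p.2 : C) := by
  let _ := CStarAlgebra.spectralOrder C
  let _ := CStarAlgebra.spectralOrderedRing C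
  let _ : SMul Cᵐᵒᵖ (PreE n C) := ⟨fun c f => mulRight c.unop f⟩
  let _ := preCStarModule n C
  let inner' : PreE n C →+ PreE n C →+ C :=
    { toFun := fun f =>
        { toFun := fun g => inner C f g
          map_zero' := congrArg MulOpposite.unop
            (CStarModule.inner_zero_right (A := Cᵐᵒᵖ) (x := f))
          map_add' := fun g h => gram_add_right f g h }
      map_zero' := by
        ext g
        exact congrArg MulOpposite.unop (CStarModule.inner_zero_left (A := Cᵐᵒᵖ) (x := g))
      map_add' := fun f g => by
        ext h
        exact congrArg MulOpposite.unop
          (CStarModule.inner_add_left (A := Cᵐᵒᵖ) (x := f) (y := g) (z := h)) }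
  have h : Continuous fun p : PreE n C × PreE n C => inner' p.1 p.2 := continuous_inner_preE n C
  exact (UniformSpace.Completion.isDenseInducing_toCompl (PreE n C)).extend_Z_bilin
    (UniformSpace.Completion.isDenseInducing_toCompl (PreE n C)) h

/-- The bounded operator `A` on `E_n` belongs to the C⋆-algebra of adjointable operators: it has an
adjoint `B` (which is then automatically linear and bounded). -/
def IsAdjointable (A : E n C →L[ℂ] E n C) : Prop :=
  ∃ B : E n C → E n C, ∀ u v : E n C, (inner C (A u) v : C) = inner C u (B v)

/-! ### The canonical unitaries and the Heisenberg action -/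

theorem hasTemperateGrowth_exp_mul_I :
    Function.HasTemperateGrowth fun t : ℝ => Complex.exp (t * Complex.I) := by
  have hc : ContDiff ℝ ∞ fun t : ℝ => Complex.exp (t * Complex.I) :=
    (Complex.ofRealCLM.contDiff.mul contDiff_const).cexp
  have hd : ∀ k : ℕ, iteratedDeriv k (fun t : ℝ => Complex.exp (t * Complex.I)) =
      fun t : ℝ => Complex.I ^ k * Complex.exp (t * Complex.I) := by
    intro k
    induction k with
    | zero => simp
    | succ k ih =>
      rw [iteratedDeriv_succ, ih]
      funext t
      have h1 : HasDerivAt (fun t : ℝ => (t : ℂ) * Complex.I) (1 * Complex.I) t :=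
        (Complex.ofRealCLM.hasDerivAt (x := t)).mul_const Complex.I
      have h2 := (h1.cexp.const_mul (Complex.I ^ k)).deriv
      rw [h2]
      ring
  refine ⟨hc, fun k => ⟨0, 1, fun t => ?_⟩⟩
  rw [norm_iteratedFDeriv_eq_norm_iteratedDeriv, hd k]
  simp [Complex.norm_exp_ofReal_mul_I]

theorem hasTemperateGrowth_exp_inner (b : EuclideanSpace ℝ (Fin n)) :
    Function.HasTemperateGrowth fun x : EuclideanSpace ℝ (Fin n) =>
      Complex.exp ((inner ℝ b x : ℝ) * Complex.I) :=
  hasTemperateGrowth_exp_mul_I.comp (Function.hasTemperateGrowth_inner_right b)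

/-- The operator `f ↦ e^{ic} e^{i⟨b, ·⟩} f(· - a)` on the Schwartz space. -/
def schwartzU (a b : EuclideanSpace ℝ (Fin n)) (c : ℝ) :
    𝓢(EuclideanSpace ℝ (Fin n), C) →ₗ[ℂ] 𝓢(EuclideanSpace ℝ (Fin n), C) :=
  Complex.exp (c * Complex.I) •
    ((SchwartzMap.smulLeftCLM C fun x : EuclideanSpace ℝ (Fin n) =>
        Complex.exp ((inner ℝ b x : ℝ) * Complex.I)).comp
      (SchwartzMap.compSubConstCLM ℂ a)).toLinearMap

theorem schwartzU_apply (a b : EuclideanSpace ℝ (Fin n)) (c : ℝ)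
    (f : 𝓢(EuclideanSpace ℝ (Fin n), C)) (x : EuclideanSpace ℝ (Fin n)) :
    schwartzU a b c f x =
      Complex.exp (c * Complex.I) • Complex.exp ((inner ℝ b x : ℝ) * Complex.I) • f (x - a) := by
  simp [schwartzU, SchwartzMap.smulLeftCLM_apply_apply (hasTemperateGrowth_exp_inner b)]

/-- `schwartzU a b c` is invertible. -/
def schwartzUEquiv (a b : EuclideanSpace ℝ (Fin n)) (c : ℝ) :
    𝓢(EuclideanSpace ℝ (Fin n), C) ≃ₗ[ℂ] 𝓢(EuclideanSpace ℝ (Fin n), C) :=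
  LinearEquiv.ofLinearMap (schwartzU a b c) (schwartzU (-a) (-b) (-c - inner ℝ b a))
    (by
      ext f x
      simp only [LinearMap.comp_apply, LinearMap.id_apply, schwartzU_apply, smul_smul,
        ← Complex.exp_add]
      rw [sub_neg_eq_add, sub_add_cancel]
      convert one_smul ℂ (f x)
      rw [← Complex.exp_zero]
      congr 1
      simp only [inner_sub_right, inner_neg_left]
      push_cast
      ring)
    (by
      ext f x
      simp only [LinearMap.comp_apply, LinearMap.id_apply, schwartzU_apply, smul_smul,
        ← Complex.exp_add]
      rw [sub_neg_eq_add, add_sub_cancel_right]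
      convert one_smul ℂ (f x)
      rw [← Complex.exp_zero]
      congr 1
      simp only [inner_add_right, inner_neg_left]
      push_cast
      ring)

theorem norm_schwartzUEquiv (a b : EuclideanSpace ℝ (Fin n)) (c : ℝ)
    (f : 𝓢(EuclideanSpace ℝ (Fin n), C)) :
    ‖ofSchwartz (schwartzUEquiv a b c f)‖ = ‖ofSchwartz f‖ := by
  have hpt : ∀ x, star (schwartzUEquiv a b c f x) * schwartzUEquiv a b c f x =
      star (f (x - a)) * f (x - a) := by
    intro x
    change star (schwartzU a b c f x) * schwartzU a b c f x = _
    rw [schwartzU_apply]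
    simp only [smul_smul, star_smul, smul_mul_assoc, mul_smul_comm, ← Complex.exp_add]
    convert one_smul ℂ (star (f (x - a)) * f (x - a))
    rw [← add_mul, ← Complex.ofReal_add, Complex.star_def, ← Complex.exp_conj, ← Complex.exp_add,
      ← Complex.exp_zero]
    congr 1
    simp
  rw [norm_ofSchwartz, norm_ofSchwartz]
  simp only [hpt]
  rw [integral_sub_right_eq_self (fun x => star (f x) * f x) a]

/-- The unitary operator `U_{a,b,c}` on `E_n`: the extension by continuity of
`f ↦ e^{ic} e^{i⟨b, ·⟩} f(· - a)`. -/
def U (a b : EuclideanSpace ℝ (Fin n)) (c : ℝ) : E n C ≃ₗᵢ[ℂ] E n C :=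
  (schwartzUEquiv a b c).extendOfIsometry ofSchwartz ofSchwartz
    denseRange_ofSchwartz denseRange_ofSchwartz (norm_schwartzUEquiv a b c)

theorem U_ofSchwartz (a b : EuclideanSpace ℝ (Fin n)) (c : ℝ)
    (f : 𝓢(EuclideanSpace ℝ (Fin n), C)) :
    U a b c (ofSchwartz f) = ofSchwartz (schwartzU a b c f) :=
  LinearEquiv.extendOfIsometry_eq _ _ _ _ _ _ f

/-- The conjugation `(Ad U)(a, b, c)(A) = U_{a,b,c} A U_{a,b,c}⁻¹`. -/
def AdU (a b : EuclideanSpace ℝ (Fin n)) (c : ℝ) (A : E n C →L[ℂ] E n C) : E n C →L[ℂ] E n C :=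
  (U a b c).toContinuousLinearEquiv.toContinuousLinearMap ∘L A ∘L
    (U a b c).symm.toContinuousLinearEquiv.toContinuousLinearMap

/-- The bounded operator `A` is a smooth vector for `Ad U`: the orbit map `g ↦ (Ad U)(g)(A)` is of
class `C^∞` for the operator norm, in the global chart `(a, b, c) ∈ ℝⁿ × ℝⁿ × ℝ` of the
Heisenberg group. (The adjointable operators are closed for the operator norm, so for an
adjointable `A` it does not matter whether the orbit map takes its values in them or in all
bounded operators.) -/
def IsHeisenbergSmooth (A : E n C →L[ℂ] E n C) : Prop :=
  ContDiff ℝ ∞ fun g : EuclideanSpace ℝ (Fin n) × EuclideanSpace ℝ (Fin n) × ℝ =>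
    AdU g.1 g.2.1 g.2.2 A

end E

end

end HeisenbergModule

/-! Call `u` in `E n C` a smooth vector if its orbit `(a, b) ↦ U_{a,b,0} u` is `C^∞`; the central
parameter `c` only contributes a scalar. Since `U A u = (U A U⁻¹)(U u)`, a Heisenberg smooth `A`
preserves smooth vectors (`IsHeisenbergSmooth.isSmoothVector_apply`). It remains to see that the
smooth vectors are exactly the Schwartz functions (`isSmoothVector_ofSchwartz`,
`IsSmoothVector.exists_eq_ofSchwartz`).

The hard inclusion is that smooth vectors are Schwartz, because elements of the completion are not
given as functions. Let `w = (1 + ‖x‖²)^{-(n+1)}`. By a Cauchy–Schwarz inequality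
(`norm_integral_smul_le`) the functional `u ↦ ∫ w u` is bounded, so the transform `b ↦ ∫ w(x)
e^{i⟨b,x⟩} u(x) dx` makes sense on all of `E n C`. For smooth `u`, its derivatives in `b` are
transforms of derivatives of the orbit, and an integration by parts
(`IsWeight.inner_smul_transform`) trades a factor `i⟨b, m⟩` for a derivative of the orbit or of the
weight. Iteration shows that the transform is a Schwartz function. Fourier inversion and division by
`w` then give a Schwartz function with the same transform as `u`, and the transform is injective by
Plancherel (`eq_zero_of_transform_eq_zero`). -/

namespace HeisenbergModule

noncomputable section

open scoped FourierTransform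

variable {n : ℕ} {C : Type*} [CStarAlgebra C]

/-! ### A square integrable weight -/

/-- The weight `(1 + ‖x‖²)⁻⁽ⁿ⁺¹⁾`. -/
def weight (x : EuclideanSpace ℝ (Fin n)) : ℝ := ((1 + ‖x‖ ^ 2) ^ (n + 1))⁻¹

theorem weight_pos (x : EuclideanSpace ℝ (Fin n)) : 0 < weight x := by
  unfold weight; positivity

theorem weight_le_one (x : EuclideanSpace ℝ (Fin n)) : weight x ≤ 1 :=
  inv_le_one_of_one_le₀ (one_le_pow₀ (by nlinarith [norm_nonneg x]))

theorem contDiff_weight : ContDiff ℝ ∞ (weight : EuclideanSpace ℝ (Fin n) → ℝ) :=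
  ((contDiff_const.add (contDiff_norm_sq ℝ)).pow _).inv fun x => by positivity

theorem hasTemperateGrowth_weight :
    Function.HasTemperateGrowth (weight : EuclideanSpace ℝ (Fin n) → ℝ) := by
  convert! Function.hasTemperateGrowth_one_add_norm_sq_rpow (EuclideanSpace ℝ (Fin n))
    (-((n + 1 : ℕ) : ℝ)) using 2 with x
  rw [Real.rpow_neg (by positivity), Real.rpow_natCast, weight]

theorem hasTemperateGrowth_weight_inv :
    Function.HasTemperateGrowth fun x : EuclideanSpace ℝ (Fin n) => (weight x)⁻¹ := by
  convert! Function.hasTemperateGrowth_one_add_norm_sq_rpow (EuclideanSpace ℝ (Fin n))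
    ((n + 1 : ℕ) : ℝ) using 2 with x
  rw [Real.rpow_natCast, weight, inv_inv]

theorem integrable_weight : Integrable (weight : EuclideanSpace ℝ (Fin n) → ℝ) := by
  have h := integrable_rpow_neg_one_add_norm_sq (E := EuclideanSpace ℝ (Fin n))
    (μ := volume) (r := 2 * (n + 1 : ℕ)) (by
      simp only [finrank_euclideanSpace, Fintype.card_fin]; push_cast; linarith)
  refine h.congr (Filter.Eventually.of_forall fun x => ?_)
  simp only [weight]
  rw [show -(2 * ((n + 1 : ℕ) : ℝ)) / 2 = -((n + 1 : ℕ) : ℝ) by ring,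
    Real.rpow_neg (by positivity), Real.rpow_natCast]

theorem integrable_weight_sq :
    Integrable fun x : EuclideanSpace ℝ (Fin n) => weight x ^ 2 := by
  refine integrable_weight.mono' (contDiff_weight.continuous.pow 2).aestronglyMeasurable
    (Filter.Eventually.of_forall fun x => ?_)
  rw [Real.norm_of_nonneg (by positivity)]
  nlinarith [weight_pos x, weight_le_one x]

/-- A Peetre inequality: `1 + ‖x‖² ≤ 1 + 2‖x + h‖² + 2‖h‖² ≤ 3(1 + ‖x + h‖²)`. It brings Taylor
remainders at nearby points back to `x`. -/
theorem weight_add_le (x h : EuclideanSpace ℝ (Fin n)) (hh : ‖h‖ ≤ 1) :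
    weight (x + h) ≤ 3 ^ (n + 1) * weight x := by
  have h1 : ‖x‖ ≤ ‖x + h‖ + ‖h‖ := by simpa using norm_sub_le (x + h) h
  have h2 : 1 + ‖x‖ ^ 2 ≤ 3 * (1 + ‖x + h‖ ^ 2) := by
    have := norm_nonneg x
    have := norm_nonneg h
    nlinarith [sq_nonneg (‖x + h‖ - ‖h‖)]
  unfold weight
  rw [← div_eq_mul_inv, le_div_iff₀ (by positivity), inv_mul_le_iff₀ (by positivity), mul_comm,
    ← mul_pow]
  gcongr

/-- The `L²` norm of `weight`. -/
def weightNorm (n : ℕ) : ℝ := √(∫ x : EuclideanSpace ℝ (Fin n), weight x ^ 2)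

theorem weightNorm_sq :
    weightNorm n ^ 2 = ∫ x : EuclideanSpace ℝ (Fin n), weight x ^ 2 :=
  Real.sq_sqrt (integral_nonneg fun x => by positivity)

theorem weightNorm_nonneg : 0 ≤ weightNorm n := Real.sqrt_nonneg _

/-- Turns pointwise bounds into bounds in `E n C`, through the C⋆-identity `‖f(x)^* f(x)‖ =
‖f(x)‖²`. -/
theorem norm_ofSchwartz_le (f : 𝓢(EuclideanSpace ℝ (Fin n), C)) {K : ℝ} (hK : 0 ≤ K)
    (hf : ∀ x, ‖f x‖ ≤ K * weight x) : ‖ofSchwartz f‖ ≤ K * weightNorm n := by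
  rw [norm_ofSchwartz]
  refine Real.sqrt_le_iff.2 ⟨mul_nonneg hK weightNorm_nonneg, ?_⟩
  rw [mul_pow, weightNorm_sq, ← integral_const_mul]
  refine norm_integral_le_of_norm_le (integrable_weight_sq.const_mul _)
    (Filter.Eventually.of_forall fun x => ?_)
  calc ‖star (f x) * f x‖ = ‖f x‖ ^ 2 := by rw [CStarRing.norm_star_mul_self, sq]
    _ ≤ (K * weight x) ^ 2 := by gcongr; exact hf x
    _ = _ := by ring

theorem exists_norm_pow_mul_iteratedFDeriv_le_weight (f : 𝓢(EuclideanSpace ℝ (Fin n), C))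
    (j k : ℕ) : ∃ K, 0 ≤ K ∧ ∀ x, ‖x‖ ^ j * ‖iteratedFDeriv ℝ k f x‖ ≤ K * weight x := by
  -- The extra `2(n + 1)` powers of `1 + ‖x‖` pay for the inverse weight, as `1 + ‖x‖² ≤ (1 +
  -- ‖x‖)²`.
  refine ⟨2 ^ (2 * (n + 1) + j) * (Finset.Iic (2 * (n + 1) + j, k)).sup
    (fun m => SchwartzMap.seminorm ℝ m.1 m.2) f, by positivity, fun x => ?_⟩
  have h := SchwartzMap.one_add_le_sup_seminorm_apply (𝕜 := ℝ) (m := (2 * (n + 1) + j, k))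
    le_rfl le_rfl f x
  rw [weight, ← div_eq_mul_inv, le_div_iff₀ (by positivity), mul_comm]
  refine le_trans ?_ h
  rw [pow_add (1 + ‖x‖) (2 * (n + 1)) j, pow_mul, ← mul_assoc]
  gcongr
  · nlinarith [norm_nonneg x]
  · linarith

/-! ### Functionals given by weights -/

theorem integrable_smul_schwartz {φ : EuclideanSpace ℝ (Fin n) → ℝ} (hφ : Continuous φ) {K : ℝ}
    (hK : ∀ x, |φ x| ≤ K * weight x) (f : 𝓢(EuclideanSpace ℝ (Fin n), C)) :
    Integrable fun x => φ x • f x := by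
  have hK0 : 0 ≤ K := nonneg_of_mul_nonneg_left ((abs_nonneg _).trans (hK 0)) (weight_pos 0)
  refine (f.integrable.norm.const_mul K).mono' (hφ.smul f.continuous).aestronglyMeasurable
    (Filter.Eventually.of_forall fun x => ?_)
  rw [norm_smul, Real.norm_eq_abs]
  gcongr
  exact (hK x).trans (mul_le_of_le_one_right hK0 (weight_le_one x))

/-- Cauchy–Schwarz in the Hilbert module against the function `φ · 1`, which need not be Schwartz;
hence the classical argument is redone by hand. -/
theorem norm_integral_smul_le {φ : EuclideanSpace ℝ (Fin n) → ℝ} (hφ : Continuous φ) {K : ℝ}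
    (hK : ∀ x, |φ x| ≤ K * weight x) (f : 𝓢(EuclideanSpace ℝ (Fin n), C)) :
    ‖∫ x, φ x • f x‖ ≤ K * weightNorm n * ‖ofSchwartz f‖ := by
  let _ := CStarAlgebra.spectralOrder C
  let _ := CStarAlgebra.spectralOrderedRing C
  have hK0 : 0 ≤ K := nonneg_of_mul_nonneg_left ((abs_nonneg _).trans (hK 0)) (weight_pos 0)
  set c : C := ∫ x, φ x • f x with hc
  have hint := integrable_smul_schwartz hφ hK f
  have hφ2 : Integrable fun x => φ x ^ 2 := by
    refine (integrable_weight_sq.const_mul (K ^ 2)).mono' (hφ.pow 2).aestronglyMeasurable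
      (Filter.Eventually.of_forall fun x => ?_)
    rw [Real.norm_of_nonneg (sq_nonneg _), ← mul_pow, ← sq_abs]
    gcongr
    exact hK x
  have hI : ∫ x, φ x ^ 2 ≤ (K * weightNorm n) ^ 2 := by
    rw [mul_pow, weightNorm_sq, ← integral_const_mul]
    refine integral_mono hφ2 (integrable_weight_sq.const_mul _) fun x => ?_
    dsimp only
    rw [← mul_pow, ← sq_abs]
    gcongr
    exact hK x
  have hstar : ∫ x, φ x • star (f x) = star c := by
    have h := ((starL' ℝ : C ≃L[ℝ] C) : C →L[ℝ] C).integral_comp_comm hint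
    have h2 : star c = ∫ x, star (φ x • f x) := h.symm
    rw [h2]
    simp
  have hintstar : Integrable fun x => φ x • star (f x) := by
    have h := ((starL' ℝ : C ≃L[ℝ] C) : C →L[ℝ] C).integrable_comp hint
    refine h.congr (Filter.Eventually.of_forall fun x => ?_)
    simp
  -- Expand the positive element `∫ (f - tφc)^* (f - tφc)`.
  have key : ∀ t : ℝ, (2 * t - t ^ 2 * ∫ x, φ x ^ 2) • (star c * c) ≤ gram f f := by
    intro t
    have hpos : 0 ≤ ∫ x, star (f x - (t * φ x) • c) * (f x - (t * φ x) • c) :=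
      integral_nonneg fun x => star_mul_self_nonneg _
    have hexp : ∀ x, star (f x - (t * φ x) • c) * (f x - (t * φ x) • c) =
        star (f x) * f x - t • (star c * (φ x • f x)) - t • ((φ x • star (f x)) * c) +
          φ x ^ 2 • (t ^ 2 • (star c * c)) := by
      intro x
      simp only [star_sub, star_smul, star_trivial, sub_mul, mul_sub, smul_mul_assoc,
        mul_smul_comm, smul_smul, smul_sub]
      rw [show t * φ x * (t * φ x) = φ x ^ 2 * t ^ 2 by ring]
      abel
    simp only [hexp] at hpos
    have i1 := integrable_gram f f
    have i2 : Integrable fun x => t • (star c * (φ x • f x)) := (hint.const_mul _).smul t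
    have i3 : Integrable fun x => t • ((φ x • star (f x)) * c) := (hintstar.mul_const _).smul t
    have i4 : Integrable fun x => φ x ^ 2 • (t ^ 2 • (star c * c)) := hφ2.smul_const _
    rw [integral_add (by exact (i1.sub i2).sub i3) i4, integral_sub (by exact i1.sub i2) i3,
      integral_sub i1 i2,
      integral_smul, integral_smul, integral_smul_const] at hpos
    have e1 : ∫ x, star c * (φ x • f x) = star c * c :=
      ((ContinuousLinearMap.mul ℝ C) (star c)).integral_comp_comm hint
    have e2 : ∫ x, (φ x • star (f x)) * c = star c * c := by
      rw [← hstar]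
      exact ((ContinuousLinearMap.mul ℝ C).flip c).integral_comp_comm hintstar
    rw [e1, e2] at hpos
    rw [← sub_nonneg]
    convert hpos using 1
    rw [smul_smul, sub_smul, two_mul, add_smul, gram, mul_comm (t ^ 2)]
    abel
  have hf : ‖ofSchwartz f‖ ^ 2 = ‖gram f f‖ := by
    rw [norm_ofSchwartz, Real.sq_sqrt (norm_nonneg _), gram]
  -- Take `t = 1/I`, for any positive upper bound `I` of `∫ φ²`.
  have key2 : ∀ I : ℝ, 0 < I → ∫ x, φ x ^ 2 ≤ I → ‖c‖ ^ 2 ≤ I * ‖ofSchwartz f‖ ^ 2 := by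
    intro I hI0 hle
    have h := key I⁻¹
    have h2 : I⁻¹ ≤ 2 * I⁻¹ - I⁻¹ ^ 2 * ∫ x, φ x ^ 2 := by
      have : I⁻¹ ^ 2 * ∫ x, φ x ^ 2 ≤ I⁻¹ ^ 2 * I := by gcongr
      have h3 : I⁻¹ ^ 2 * I = I⁻¹ := by field_simp
      linarith
    have h4 : I⁻¹ • (star c * c) ≤ gram f f :=
      (smul_le_smul_of_nonneg_right h2 (star_mul_self_nonneg c)).trans h
    have h5 := CStarAlgebra.norm_le_norm_of_nonneg_of_le
      (smul_nonneg (inv_nonneg.2 hI0.le) (star_mul_self_nonneg c)) h4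
    rw [norm_smul, CStarRing.norm_star_mul_self, ← sq, Real.norm_of_nonneg (inv_nonneg.2 hI0.le),
      inv_mul_le_iff₀ hI0] at h5
    rwa [hf]
  have key3 : ‖c‖ ^ 2 ≤ (K * weightNorm n) ^ 2 * ‖ofSchwartz f‖ ^ 2 := by
    refine le_of_forall_pos_le_add fun ε hε => ?_
    -- `K * weightNorm n` may vanish, so its square is enlarged by a positive amount that costs at
    -- most `ε` after multiplication by `‖f‖²`.
    have hδ : 0 < ε / (‖ofSchwartz f‖ ^ 2 + 1) := by positivity
    have h := key2 ((K * weightNorm n) ^ 2 + ε / (‖ofSchwartz f‖ ^ 2 + 1)) (by positivity)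
      (by linarith)
    have h2 : ε / (‖ofSchwartz f‖ ^ 2 + 1) * ‖ofSchwartz f‖ ^ 2 ≤ ε := by
      rw [div_mul_eq_mul_div, div_le_iff₀ (by positivity)]
      nlinarith
    linarith
  rw [← mul_pow] at key3
  exact le_of_sq_le_sq key3 (mul_nonneg (mul_nonneg hK0 weightNorm_nonneg) (norm_nonneg _))

/-- A real valued function is dominated by `weight`. -/
structure IsDominated (φ : EuclideanSpace ℝ (Fin n) → ℝ) : Prop where
  continuous : Continuous φ
  exists_le : ∃ K, ∀ x, |φ x| ≤ K * weight x

variable (C) in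
/-- The linear map `f ↦ ∫ φ f` on Schwartz functions. -/
def schwartzFunctional (φ : EuclideanSpace ℝ (Fin n) → ℝ) (hφ : IsDominated φ) :
    𝓢(EuclideanSpace ℝ (Fin n), C) →ₗ[ℂ] C where
  toFun f := ∫ x, φ x • f x
  map_add' f g := by
    obtain ⟨K, hK⟩ := hφ.exists_le
    simp only [_root_.add_apply, smul_add]
    exact integral_add (integrable_smul_schwartz hφ.continuous hK f)
      (integrable_smul_schwartz hφ.continuous hK g)
  map_smul' c f := by
    simp only [_root_.smul_apply, RingHom.id_apply, ← integral_smul]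
    simp_rw [smul_comm c]

variable (C) in
/-- The continuous extension to `E n C` of the linear map `f ↦ ∫ φ f`. -/
def functional (φ : EuclideanSpace ℝ (Fin n) → ℝ) (hφ : IsDominated φ) : E n C →L[ℂ] C :=
  (schwartzFunctional C φ hφ).extendOfNorm ofSchwartz

theorem functional_ofSchwartz {φ : EuclideanSpace ℝ (Fin n) → ℝ} (hφ : IsDominated φ)
    (f : 𝓢(EuclideanSpace ℝ (Fin n), C)) :
    functional C φ hφ (ofSchwartz f) = ∫ x, φ x • f x := by
  obtain ⟨K, hK⟩ := hφ.exists_le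
  exact LinearMap.extendOfNorm_eq denseRange_ofSchwartz
    ⟨K * weightNorm n, fun f => norm_integral_smul_le hφ.continuous hK f⟩ f

/-! ### Second order Taylor bounds -/

/-- The mean value inequality is applied to `g'`, then to `s ↦ g s - s g' 0`. The sharp constant `B
/ 2` is not needed. -/
theorem norm_sub_sub_le_of_norm_deriv_two_le {X : Type*} [NormedAddCommGroup X] [NormedSpace ℝ X]
    {g g' g'' : ℝ → X} {B : ℝ} (hg : ∀ s, HasDerivAt g (g' s) s)
    (hg' : ∀ s, HasDerivAt g' (g'' s) s) (hB : ∀ s ∈ Set.Icc (0 : ℝ) 1, ‖g'' s‖ ≤ B) :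
    ‖g 1 - g 0 - g' 0‖ ≤ B := by
  have hB0 : 0 ≤ B := (norm_nonneg _).trans (hB 0 (by simp))
  have h1 : ∀ s ∈ Set.Icc (0 : ℝ) 1, ‖g' s - g' 0‖ ≤ B := fun s hs =>
    (norm_image_sub_le_of_norm_deriv_le_segment' (fun t _ => (hg' t).hasDerivWithinAt)
      (fun t ht => hB t (Set.Ico_subset_Icc_self ht)) s hs).trans (by
        rw [sub_zero]; exact mul_le_of_le_one_right hB0 hs.2)
  have h2 := norm_image_sub_le_of_norm_deriv_le_segment_01' (f := fun s => g s - s • g' 0)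
    (f' := fun s => g' s - g' 0) (C := B) (fun s _ => by
      have h := (hg s).sub ((hasDerivAt_id s).smul_const (g' 0))
      rw [one_smul] at h
      exact h.hasDerivWithinAt)
    (fun s hs => h1 s (Set.Ico_subset_Icc_self hs))
  convert h2 using 2
  simp
  abel

theorem norm_exp_mul_I_sub_one_sub_le (s : ℝ) :
    ‖Complex.exp (s * Complex.I) - 1 - s * Complex.I‖ ≤ s ^ 2 := by
  have hd : ∀ t : ℝ, HasDerivAt (fun t : ℝ => Complex.exp ((t * s : ℝ) * Complex.I))
      ((s * Complex.I) * Complex.exp ((t * s : ℝ) * Complex.I)) t := by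
    intro t
    have h1 : HasDerivAt (fun t : ℝ => ((t * s : ℝ) : ℂ) * Complex.I) ((1 * s : ℝ) * Complex.I) t :=
      (((hasDerivAt_id t).mul_const s).ofReal_comp).mul_const Complex.I
    convert h1.cexp using 1
    push_cast
    ring
  have h := norm_sub_sub_le_of_norm_deriv_two_le (B := s ^ 2) hd
    (fun t => (hd t).const_mul (s * Complex.I)) (fun t _ => by
      rw [norm_mul, norm_mul (_ * _), Complex.norm_exp_ofReal_mul_I]
      simp [← sq])
  simpa using h

/-! ### The group law of the canonical unitaries -/

/-- The Heisenberg cocycle `-⟨b', a⟩` appears because the outer translation by `a` also shifts the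
inner character `e^{i⟨b', x⟩}`. -/
theorem schwartzU_schwartzU (a b a' b' : EuclideanSpace ℝ (Fin n)) (c c' : ℝ)
    (f : 𝓢(EuclideanSpace ℝ (Fin n), C)) :
    schwartzU a b c (schwartzU a' b' c' f) =
      schwartzU (a + a') (b + b') (c + c' - inner ℝ b' a) f := by
  ext x
  simp only [schwartzU_apply, smul_smul, ← Complex.exp_add, sub_sub]
  congr 2
  simp only [inner_sub_right, inner_add_left]
  push_cast
  ring

theorem continuous_U (a b : EuclideanSpace ℝ (Fin n)) (c : ℝ) :
    Continuous (U a b c : E n C ≃ₗᵢ[ℂ] E n C) := (U a b c).continuous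

theorem U_U (a b a' b' : EuclideanSpace ℝ (Fin n)) (c c' : ℝ) (v : E n C) :
    U a b c (U a' b' c' v) = U (a + a') (b + b') (c + c' - inner ℝ b' a) v := by
  refine denseRange_ofSchwartz.induction_on v (isClosed_eq
    ((continuous_U _ _ _).comp (continuous_U _ _ _)) (continuous_U _ _ _)) fun f => ?_
  simp only [U_ofSchwartz, schwartzU_schwartzU]

theorem U_eq_exp_smul (a b : EuclideanSpace ℝ (Fin n)) (c : ℝ) (v : E n C) :
    U a b c v = Complex.exp (c * Complex.I) • U a b 0 v := by
  refine denseRange_ofSchwartz.induction_on v (isClosed_eq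
    (continuous_U _ _ _) ((continuous_U a b 0).fun_const_smul _)) fun f => ?_
  simp only [U_ofSchwartz, ← map_smul]
  congr 1
  ext x
  simp [schwartzU_apply]

theorem U_zero (v : E n C) : U 0 0 0 v = v := by
  refine denseRange_ofSchwartz.induction_on v (isClosed_eq
    (continuous_U _ _ _) continuous_id) fun f => ?_
  rw [U_ofSchwartz]
  congr 1
  ext x
  simp [schwartzU_apply]

/-! ### Smooth vectors -/

/-- The orbit map `(a, b) ↦ U_{a,b,0} u`. -/
def orbit (u : E n C) (p : EuclideanSpace ℝ (Fin n) × EuclideanSpace ℝ (Fin n)) : E n C :=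
  U p.1 p.2 0 u

/-- The vector `u` has a smooth orbit map. -/
def IsSmoothVector (u : E n C) : Prop := ContDiff ℝ ∞ (orbit u)

/-- The group law moves the base point from `0` to `p` up to a phase, so differentiability of an
orbit at `0` gives it everywhere. -/
theorem orbit_eq_exp_smul (u : E n C) (p q : EuclideanSpace ℝ (Fin n) × EuclideanSpace ℝ (Fin n)) :
    orbit u q = Complex.exp ((inner ℝ (q - p).2 p.1 : ℝ) * Complex.I) •
      U p.1 p.2 0 (orbit u (q - p)) := by
  rw [orbit, orbit, U_U, U_eq_exp_smul _ _ (0 + 0 - _), smul_smul, ← Complex.exp_add]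
  simp

/-- Product rule for `orbit_eq_exp_smul`; the second term of `L'` is the derivative of the phase. -/
theorem hasFDerivAt_orbit {u : E n C}
    {L : EuclideanSpace ℝ (Fin n) × EuclideanSpace ℝ (Fin n) →L[ℝ] E n C}
    (h : HasFDerivAt (orbit u) L 0)
    (p : EuclideanSpace ℝ (Fin n) × EuclideanSpace ℝ (Fin n)) :
    ∃ L' : EuclideanSpace ℝ (Fin n) × EuclideanSpace ℝ (Fin n) →L[ℝ] E n C,
      HasFDerivAt (orbit u) L' p ∧
      ∀ q, L' q = orbit (L q) p + ((inner ℝ q.2 p.1 : ℝ) * Complex.I) • orbit u p := by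
  let T : EuclideanSpace ℝ (Fin n) × EuclideanSpace ℝ (Fin n) →L[ℝ] ℝ :=
    (innerSL ℝ p.1).comp (ContinuousLinearMap.snd ℝ _ _)
  have hT0 : HasFDerivAt (fun q => T (q - p)) T p := by
    simp only [map_sub]
    exact T.hasFDerivAt.sub_const _
  have hT : HasFDerivAt (fun q => Complex.exp (((T (q - p) : ℝ) : ℂ) * Complex.I)) _ p :=
    ((Complex.ofRealCLM.hasFDerivAt.comp p hT0).mul_const Complex.I).cexp
  have h0 : HasFDerivAt (fun q => orbit u (q - p)) L p := by
    refine (hasFDerivAt_comp_sub p).2 ?_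
    rwa [sub_self]
  let Up : E n C →L[ℝ] E n C :=
    ((U p.1 p.2 0 : E n C ≃ₗᵢ[ℂ] E n C).toContinuousLinearEquiv.toContinuousLinearMap).restrictScalars
      ℝ
  have hU := Up.hasFDerivAt.comp p h0
  have hmul := hT.smul hU
  have heq : orbit u = fun q => Complex.exp (((T (q - p) : ℝ) : ℂ) * Complex.I) •
      Up (orbit u (q - p)) := by
    funext q
    rw [orbit_eq_exp_smul u p q]
    congr 4
    exact real_inner_comm _ _
  refine ⟨_, hmul.congr_of_eventuallyEq (Filter.Eventually.of_forall fun q => congrFun heq q),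
    fun q => ?_⟩
  simp only [sub_self, map_zero, Complex.ofReal_zero, zero_mul, Complex.exp_zero]
  simp [Up, T, orbit, real_inner_comm p.1 q.2, U_zero, mul_comm]

theorem fderiv_orbit {u : E n C} (h : DifferentiableAt ℝ (orbit u) 0)
    (p q : EuclideanSpace ℝ (Fin n) × EuclideanSpace ℝ (Fin n)) :
    fderiv ℝ (orbit u) p q =
      orbit (fderiv ℝ (orbit u) 0 q) p + ((inner ℝ q.2 p.1 : ℝ) * Complex.I) • orbit u p := by
  obtain ⟨L', h1, h2⟩ := hasFDerivAt_orbit h.hasFDerivAt p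
  rw [h1.fderiv, h2]

theorem contDiff_inner_mul_I (q : EuclideanSpace ℝ (Fin n) × EuclideanSpace ℝ (Fin n)) :
    ContDiff ℝ ∞ fun p : EuclideanSpace ℝ (Fin n) × EuclideanSpace ℝ (Fin n) =>
      ((inner ℝ q.2 p.1 : ℝ) : ℂ) * Complex.I :=
  (Complex.ofRealCLM.contDiff.comp (contDiff_const.inner ℝ contDiff_fst)).mul contDiff_const

/-- By `fderiv_orbit`, the orbit of the derived vector is a directional derivative of the orbit of
`u` minus a smooth scalar times that orbit. -/
theorem IsSmoothVector.fderiv {u : E n C} (hu : IsSmoothVector u)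
    (q : EuclideanSpace ℝ (Fin n) × EuclideanSpace ℝ (Fin n)) :
    IsSmoothVector (fderiv ℝ (orbit u) 0 q) := by
  have hd : Differentiable ℝ (orbit u) := hu.differentiable (by simp)
  have h : orbit (_root_.fderiv ℝ (orbit u) 0 q) = fun p =>
      _root_.fderiv ℝ (orbit u) p q - (((inner ℝ q.2 p.1 : ℝ) : ℂ) * Complex.I) • orbit u p := by
    funext p
    rw [fderiv_orbit (hd 0) p, add_sub_cancel_right]
  rw [IsSmoothVector, h]
  exact ((contDiff_infty_iff_fderiv.1 hu).2.clm_apply contDiff_const).sub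
    ((contDiff_inner_mul_I q).smul hu)

/-! ### Schwartz functions are smooth vectors -/

/-- The generator `f ↦ -∂_{q.1} f + i ⟨q.2, ·⟩ f` on Schwartz functions. -/
def generator (q : EuclideanSpace ℝ (Fin n) × EuclideanSpace ℝ (Fin n))
    (f : 𝓢(EuclideanSpace ℝ (Fin n), C)) : 𝓢(EuclideanSpace ℝ (Fin n), C) :=
  -LineDeriv.lineDerivOp q.1 f +
    Complex.I • SchwartzMap.smulLeftCLM C (fun x => (inner ℝ q.2 x : ℝ)) f

theorem generator_apply (q : EuclideanSpace ℝ (Fin n) × EuclideanSpace ℝ (Fin n))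
    (f : 𝓢(EuclideanSpace ℝ (Fin n), C)) (x : EuclideanSpace ℝ (Fin n)) :
    generator q f x = -fderiv ℝ f x q.1 + ((inner ℝ q.2 x : ℝ) * Complex.I) • f x := by
  rw [generator, _root_.add_apply, _root_.neg_apply, _root_.smul_apply,
    SchwartzMap.lineDerivOp_apply_eq_fderiv,
    SchwartzMap.smulLeftCLM_apply_apply (Function.hasTemperateGrowth_inner_right q.2), mul_comm,
    mul_smul, Complex.coe_smul]

theorem exists_norm_schwartzU_translation_le (f : 𝓢(EuclideanSpace ℝ (Fin n), C)) :
    ∃ K, ∀ h : EuclideanSpace ℝ (Fin n), ‖h‖ ≤ 1 →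
      ‖ofSchwartz (schwartzU h 0 0 f - f + LineDeriv.lineDerivOp h f)‖ ≤ K * ‖h‖ ^ 2 := by
  obtain ⟨K, hK0, hK⟩ := exists_norm_pow_mul_iteratedFDeriv_le_weight f 0 2
  simp only [pow_zero, one_mul] at hK
  refine ⟨K * 3 ^ (n + 1) * weightNorm n, fun h hh => ?_⟩
  refine (norm_ofSchwartz_le _ (K := K * 3 ^ (n + 1) * ‖h‖ ^ 2) (by positivity)
    fun x => ?_).trans_eq (by ring)
  have hd : ∀ (k : 𝓢(EuclideanSpace ℝ (Fin n), C)) (s : ℝ),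
      HasDerivAt (fun s : ℝ => k (x - s • h)) (-(LineDeriv.lineDerivOp h k (x - s • h))) s := by
    intro k s
    have h1 : HasDerivAt (fun s : ℝ => x - s • h) (-h) s := by
      simpa using ((hasDerivAt_id s).smul_const h).const_sub x
    have h2 := (k.hasFDerivAt (x - s • h)).comp_hasDerivAt s h1
    rw [SchwartzMap.lineDerivOp_apply_eq_fderiv, ← map_neg]
    exact h2
  have hb := norm_sub_sub_le_of_norm_deriv_two_le (B := K * 3 ^ (n + 1) * ‖h‖ ^ 2 * weight x)
    (hd f) (fun s => (hd (LineDeriv.lineDerivOp h f) s).neg) (fun s hs => by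
      rw [neg_neg]
      have e : LineDeriv.lineDerivOp h (LineDeriv.lineDerivOp h f) (x - s • h) =
          iteratedFDeriv ℝ 2 f (x - s • h) ![h, h] := by
        rw [← SchwartzMap.iteratedLineDerivOp_eq_iteratedFDeriv]
        rfl
      rw [e]
      have hsh : ‖-(s • h)‖ ≤ 1 := by
        rw [norm_neg, norm_smul, Real.norm_of_nonneg hs.1]
        exact mul_le_one₀ hs.2 (norm_nonneg _) hh
      calc _ ≤ ‖iteratedFDeriv ℝ 2 f (x - s • h)‖ * ∏ i, ‖(![h, h] : Fin 2 → _) i‖ :=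
            ContinuousMultilinearMap.le_opNorm _ _
        _ = ‖iteratedFDeriv ℝ 2 f (x - s • h)‖ * ‖h‖ ^ 2 := by simp [Fin.prod_univ_two, sq]
        _ ≤ (K * (3 ^ (n + 1) * weight x)) * ‖h‖ ^ 2 := by
            gcongr
            refine (hK _).trans ?_
            gcongr
            rw [sub_eq_add_neg]
            exact weight_add_le x _ hsh
        _ = _ := by ring)
  have e : (schwartzU h 0 0 f - f + LineDeriv.lineDerivOp h f) x =
      f (x - (1 : ℝ) • h) - f (x - (0 : ℝ) • h) -
        -(LineDeriv.lineDerivOp h f) (x - (0 : ℝ) • h) := by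
    rw [_root_.add_apply, _root_.sub_apply, schwartzU_apply]
    simp
  rw [e]
  exact hb

theorem exists_norm_schwartzU_modulation_le (f : 𝓢(EuclideanSpace ℝ (Fin n), C)) :
    ∃ K, ∀ k : EuclideanSpace ℝ (Fin n),
      ‖ofSchwartz (schwartzU 0 k 0 f - f - generator (0, k) f)‖ ≤ K * ‖k‖ ^ 2 := by
  obtain ⟨K, hK0, hK⟩ := exists_norm_pow_mul_iteratedFDeriv_le_weight f 2 0
  simp only [norm_iteratedFDeriv_zero] at hK
  refine ⟨K * weightNorm n, fun k => ?_⟩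
  refine (norm_ofSchwartz_le _ (K := K * ‖k‖ ^ 2) (by positivity) fun x => ?_).trans_eq (by ring)
  have e : (schwartzU 0 k 0 f - f - generator (0, k) f) x =
      (Complex.exp ((inner ℝ k x : ℝ) * Complex.I) - 1 - (inner ℝ k x : ℝ) * Complex.I) • f x := by
    simp [schwartzU_apply, generator_apply, sub_smul]
  rw [e, norm_smul]
  calc _ ≤ (inner ℝ k x : ℝ) ^ 2 * ‖f x‖ := by
        gcongr; exact norm_exp_mul_I_sub_one_sub_le _
    _ ≤ (‖k‖ * ‖x‖) ^ 2 * ‖f x‖ := by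
        rw [← sq_abs]
        gcongr
        exact abs_real_inner_le_norm k x
    _ = ‖k‖ ^ 2 * (‖x‖ ^ 2 * ‖f x‖) := by ring
    _ ≤ ‖k‖ ^ 2 * (K * weight x) := by gcongr ?_ * ?_; exact hK x
    _ = _ := by ring

/-- The cross term caused by modulating after translating: `‖e^{is} - 1‖ ≤ |s|` with `s = ⟨k, x⟩`
supplies the factor `‖k‖`. -/
theorem exists_norm_schwartzU_lineDerivOp_le (f : 𝓢(EuclideanSpace ℝ (Fin n), C)) :
    ∃ K, ∀ h k : EuclideanSpace ℝ (Fin n),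
      ‖ofSchwartz (schwartzU 0 k 0 (LineDeriv.lineDerivOp h f) - LineDeriv.lineDerivOp h f)‖ ≤
        K * (‖h‖ * ‖k‖) := by
  obtain ⟨K, hK0, hK⟩ := exists_norm_pow_mul_iteratedFDeriv_le_weight f 1 1
  simp only [norm_iteratedFDeriv_one, pow_one] at hK
  refine ⟨K * weightNorm n, fun h k => ?_⟩
  refine (norm_ofSchwartz_le _ (K := K * (‖h‖ * ‖k‖)) (by positivity)
    fun x => ?_).trans_eq (by ring)
  have e : (schwartzU 0 k 0 (LineDeriv.lineDerivOp h f) - LineDeriv.lineDerivOp h f) x =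
      (Complex.exp (Complex.I * (inner ℝ k x : ℝ)) - 1) • fderiv ℝ f x h := by
    simp [schwartzU_apply, sub_smul, SchwartzMap.lineDerivOp_apply_eq_fderiv, mul_comm]
  rw [e, norm_smul]
  calc _ ≤ ‖(inner ℝ k x : ℝ)‖ * (‖fderiv ℝ f x‖ * ‖h‖) := by
        gcongr
        · exact Real.norm_exp_I_mul_ofReal_sub_one_le
        · exact ContinuousLinearMap.le_opNorm _ _
    _ ≤ (‖k‖ * ‖x‖) * (‖fderiv ℝ f x‖ * ‖h‖) := by
        gcongr
        exact abs_real_inner_le_norm k x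
    _ = ‖h‖ * ‖k‖ * (‖x‖ * ‖fderiv ℝ f x‖) := by ring
    _ ≤ ‖h‖ * ‖k‖ * (K * weight x) := by gcongr ?_ * ?_; exact hK x
    _ = _ := by ring

/-- The linear map `q ↦ generator q f`, with values in `E n C`. -/
def generatorCLM (f : 𝓢(EuclideanSpace ℝ (Fin n), C)) :
    EuclideanSpace ℝ (Fin n) × EuclideanSpace ℝ (Fin n) →L[ℝ] E n C :=
  LinearMap.toContinuousLinearMap
    { toFun := fun q => ofSchwartz (generator q f)
      map_add' := fun q q' => by
        rw [← map_add]
        congr 1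
        ext x
        simp only [generator_apply, _root_.add_apply, Prod.fst_add, Prod.snd_add, map_add,
          inner_add_left, Complex.ofReal_add, add_mul, add_smul]
        abel
      map_smul' := fun r q => by
        rw [RingHom.id_apply, ← Complex.coe_smul, ← map_smul]
        congr 1
        ext x
        simp only [generator_apply, _root_.smul_apply, Prod.smul_fst, Prod.smul_snd, map_smul,
          inner_smul_left, smul_add, smul_neg, Complex.coe_smul]
        simp [mul_smul] }

theorem generatorCLM_apply (f : 𝓢(EuclideanSpace ℝ (Fin n), C))
    (q : EuclideanSpace ℝ (Fin n) × EuclideanSpace ℝ (Fin n)) :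
    generatorCLM f q = ofSchwartz (generator q f) := rfl

theorem hasFDerivAt_orbit_ofSchwartz (f : 𝓢(EuclideanSpace ℝ (Fin n), C)) :
    HasFDerivAt (orbit (ofSchwartz f)) (generatorCLM f) 0 := by
  obtain ⟨K₁, h₁⟩ := exists_norm_schwartzU_translation_le f
  obtain ⟨K₂, h₂⟩ := exists_norm_schwartzU_modulation_le f
  obtain ⟨K₃, h₃⟩ := exists_norm_schwartzU_lineDerivOp_le f
  have hO : (fun q => orbit (ofSchwartz f) q - ofSchwartz f - generatorCLM f q) =O[nhds 0]
      fun q => ‖q - 0‖ ^ 2 := by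
    refine Asymptotics.IsBigO.of_bound (|K₁| + |K₂| + |K₃|) ?_
    filter_upwards [Metric.closedBall_mem_nhds (0 : EuclideanSpace ℝ (Fin n) ×
      EuclideanSpace ℝ (Fin n)) one_pos] with q hq
    rw [mem_closedBall_zero_iff] at hq
    have hq1 : ‖q.1‖ ≤ ‖q‖ := norm_fst_le q
    have hq2 : ‖q.2‖ ≤ ‖q‖ := norm_snd_le q
    -- Factor `U_{h,k} = U_{0,k} U_{h,0}`: the error splits into a translation, a modulation and a
    -- cross term, each quadratic in `q`.
    have e : orbit (ofSchwartz f) q - ofSchwartz f - generatorCLM f q =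
        U 0 q.2 0 (ofSchwartz (schwartzU q.1 0 0 f - f + LineDeriv.lineDerivOp q.1 f)) +
        ofSchwartz (schwartzU 0 q.2 0 f - f - generator (0, q.2) f) -
        ofSchwartz (schwartzU 0 q.2 0 (LineDeriv.lineDerivOp q.1 f) -
          LineDeriv.lineDerivOp q.1 f) := by
      rw [orbit, generatorCLM_apply, U_ofSchwartz, U_ofSchwartz]
      simp only [← map_add, ← map_sub]
      congr 1
      simp only [map_add, map_sub, schwartzU_schwartzU]
      ext x
      simp [generator_apply, schwartzU_apply, SchwartzMap.lineDerivOp_apply_eq_fderiv]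
      abel
    rw [e]
    refine (norm_sub_le _ _).trans ?_
    refine (add_le_add_left (norm_add_le _ _) _).trans ?_
    rw [LinearIsometryEquiv.norm_map, sub_zero, norm_pow, norm_norm, add_mul, add_mul]
    gcongr
    · refine (h₁ q.1 (hq1.trans hq)).trans ?_
      gcongr
      exact le_abs_self K₁
    · refine (h₂ q.2).trans ?_
      gcongr
      exact le_abs_self K₂
    · refine (h₃ q.1 q.2).trans ?_
      rw [sq]
      gcongr
      exact le_abs_self K₃
  have h := (hO.hasFDerivAt (by norm_num)).add
    ((generatorCLM f).hasFDerivAt.add_const (ofSchwartz f))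
  rw [zero_add] at h
  refine h.congr_of_eventuallyEq (Filter.Eventually.of_forall fun q => ?_)
  simp only [Pi.add_apply]
  abel

/-- Directional derivatives of the orbit of `f` involve only the orbits of `generator q f` and `f`,
both Schwartz, so induction on the order applies to all `f` at once. -/
theorem isSmoothVector_ofSchwartz (f : 𝓢(EuclideanSpace ℝ (Fin n), C)) :
    IsSmoothVector (ofSchwartz f) := by
  refine contDiff_infty.2 fun m => ?_
  induction m generalizing f with
  | zero =>
    refine contDiff_zero.2 (continuous_iff_continuousAt.2 fun p => ?_)
    obtain ⟨L', h, -⟩ := hasFDerivAt_orbit (hasFDerivAt_orbit_ofSchwartz f) p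
    exact h.continuousAt
  | succ m ih =>
    have hd : Differentiable ℝ (orbit (ofSchwartz f)) := fun p => by
      obtain ⟨L', h, -⟩ := hasFDerivAt_orbit (hasFDerivAt_orbit_ofSchwartz f) p
      exact h.differentiableAt
    refine contDiff_succ_iff_fderiv_apply.2 ⟨hd, fun h => absurd h (WithTop.natCast_ne_top m),
      fun q => ?_⟩
    have h : (fun p => fderiv ℝ (orbit (ofSchwartz f)) p q) = fun p =>
        orbit (ofSchwartz (generator q f)) p +
          (((inner ℝ q.2 p.1 : ℝ) : ℂ) * Complex.I) • orbit (ofSchwartz f) p := by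
      funext p
      rw [fderiv_orbit (hd 0), (hasFDerivAt_orbit_ofSchwartz f).fderiv, generatorCLM_apply]
    rw [h]
    exact (ih _).add (((contDiff_inner_mul_I q).of_le (by exact_mod_cast le_top)).smul (ih f))

/-! ### Heisenberg smooth operators preserve smooth vectors -/

theorem contDiff_complex_clm_apply {P X : Type*} [NormedAddCommGroup P] [NormedSpace ℝ P]
    [NormedAddCommGroup X] [NormedSpace ℂ X] {G : P → X →L[ℂ] X} {F : P → X}
    (hG : ContDiff ℝ ∞ G) (hF : ContDiff ℝ ∞ F) : ContDiff ℝ ∞ fun p => G p (F p) :=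
  ((ContinuousLinearMap.restrictScalarsL ℂ X X ℝ ℝ).contDiff.comp hG).clm_apply hF

theorem contDiff_AdU {A : E n C →L[ℂ] E n C} (hA : IsHeisenbergSmooth A) :
    ContDiff ℝ ∞ fun p : EuclideanSpace ℝ (Fin n) × EuclideanSpace ℝ (Fin n) =>
      AdU p.1 p.2 0 A := by
  have hi : ContDiff ℝ ∞ fun p : EuclideanSpace ℝ (Fin n) × EuclideanSpace ℝ (Fin n) =>
      (p.1, p.2, (0 : ℝ)) := contDiff_fst.prodMk (contDiff_snd.prodMk contDiff_const)
  unfold IsHeisenbergSmooth at hA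
  generalize hG : (fun g : EuclideanSpace ℝ (Fin n) × EuclideanSpace ℝ (Fin n) × ℝ =>
    AdU g.1 g.2.1 g.2.2 A) = G at hA
  have h := hA.comp hi
  have e : (fun p : EuclideanSpace ℝ (Fin n) × EuclideanSpace ℝ (Fin n) =>
      AdU p.1 p.2 0 A) = G ∘ fun p => (p.1, p.2, (0 : ℝ)) := by
    rw [← hG]; rfl
  rw [e]
  exact h
theorem IsHeisenbergSmooth.isSmoothVector_apply {A : E n C →L[ℂ] E n C} (hA : IsHeisenbergSmooth A)
    {u : E n C} (hu : IsSmoothVector u) : IsSmoothVector (A u) := by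
  have h1 := contDiff_AdU hA
  have e : orbit (A u) = fun p : EuclideanSpace ℝ (Fin n) × EuclideanSpace ℝ (Fin n) =>
      AdU p.1 p.2 0 A (orbit u p) := by
    funext p
    change _ = U p.1 p.2 0 (A ((U p.1 p.2 0).symm (U p.1 p.2 0 u)))
    rw [LinearIsometryEquiv.symm_apply_apply, orbit]
  rw [IsSmoothVector, e]
  exact contDiff_complex_clm_apply h1 hu

/-! ### Weights stable under differentiation -/

/-- The function `(1 + ‖x‖²)⁻¹`. -/
def bracketInv (x : EuclideanSpace ℝ (Fin n)) : ℝ := (1 + ‖x‖ ^ 2)⁻¹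

/-- The functions obtained from `weight` by linear combinations and by multiplication with
`(1 + ‖x‖²)⁻¹` and `⟨m, x⟩ (1 + ‖x‖²)⁻¹`. -/
inductive IsWeight : (EuclideanSpace ℝ (Fin n) → ℝ) → Prop
  | base : IsWeight weight
  | bracketInv_mul {φ : EuclideanSpace ℝ (Fin n) → ℝ} :
      IsWeight φ → IsWeight fun x => bracketInv x * φ x
  | inner_mul (m : EuclideanSpace ℝ (Fin n)) {φ : EuclideanSpace ℝ (Fin n) → ℝ} :
      IsWeight φ → IsWeight fun x => inner ℝ m x * bracketInv x * φ x
  | add {φ ψ : EuclideanSpace ℝ (Fin n) → ℝ} :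
      IsWeight φ → IsWeight ψ → IsWeight fun x => φ x + ψ x
  | const_mul (c : ℝ) {φ : EuclideanSpace ℝ (Fin n) → ℝ} : IsWeight φ → IsWeight fun x => c * φ x

theorem hasFDerivAt_bracketInv (x : EuclideanSpace ℝ (Fin n)) :
    HasFDerivAt bracketInv ((-2 * bracketInv x ^ 2) • innerSL ℝ x) x := by
  have h1 : HasFDerivAt (fun x : EuclideanSpace ℝ (Fin n) => 1 + ‖x‖ ^ 2)
      (2 • (innerSL ℝ x)) x := (hasStrictFDerivAt_norm_sq x).hasFDerivAt.const_add 1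
  have h2 := (hasDerivAt_inv (x := 1 + ‖x‖ ^ 2) (by positivity)).comp_hasFDerivAt x h1
  convert! h2 using 1
  ext h
  simp [bracketInv]
  ring

theorem hasFDerivAt_inner_mul_bracketInv (m x : EuclideanSpace ℝ (Fin n)) :
    HasFDerivAt (fun x => inner ℝ m x * bracketInv x)
      ((inner ℝ m x : ℝ) • ((-2 * bracketInv x ^ 2) • innerSL ℝ x) +
        bracketInv x • innerSL ℝ m) x :=
  (innerSL ℝ m).hasFDerivAt.mul (hasFDerivAt_bracketInv x)

theorem hasFDerivAt_weight (x : EuclideanSpace ℝ (Fin n)) :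
    HasFDerivAt weight ((-2 * (n + 1) * bracketInv x * weight x) • innerSL ℝ x) x := by
  have h := (hasFDerivAt_bracketInv x).pow (n + 1)
  have e : (weight : EuclideanSpace ℝ (Fin n) → ℝ) = fun x => bracketInv x ^ (n + 1) := by
    funext x
    rw [weight, bracketInv, inv_pow]
  rw [e]
  convert! h using 1
  ext h
  simp
  ring

theorem IsWeight.differentiable {φ : EuclideanSpace ℝ (Fin n) → ℝ} (hφ : IsWeight φ) :
    Differentiable ℝ φ := by
  induction hφ with
  | base => exact fun x => (hasFDerivAt_weight x).differentiableAt
  | bracketInv_mul _ ih =>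
    exact fun x => (hasFDerivAt_bracketInv x).differentiableAt.mul (ih x)
  | inner_mul m _ ih =>
    exact fun x => (hasFDerivAt_inner_mul_bracketInv m x).differentiableAt.mul (ih x)
  | add _ _ ih₁ ih₂ => exact ih₁.add ih₂
  | const_mul c _ ih => exact ih.const_mul c

/-- The class is designed for this closure: `∂_h (1 + ‖x‖²)⁻¹ = -2 ⟨h, x⟩ (1 + ‖x‖²)⁻²`. Repeated
integrations by parts thus stay among bounded functionals. -/
theorem IsWeight.fderiv {φ : EuclideanSpace ℝ (Fin n) → ℝ} (hφ : IsWeight φ)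
    (h : EuclideanSpace ℝ (Fin n)) : IsWeight fun x => fderiv ℝ φ x h := by
  induction hφ with
  | base =>
    convert! (IsWeight.inner_mul h IsWeight.base).const_mul (-2 * (n + 1)) using 2 with x
    rw [(hasFDerivAt_weight x).fderiv]
    simp [real_inner_comm]
    ring
  | @bracketInv_mul φ hφ ih =>
    convert! ((hφ.bracketInv_mul.inner_mul h).const_mul (-2)).add ih.bracketInv_mul using 2 with x
    rw [((hasFDerivAt_bracketInv x).fun_mul (hφ.differentiable x).hasFDerivAt).fderiv]
    simp [real_inner_comm]
    ring
  | @inner_mul m φ hφ ih =>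
    convert! ((((hφ.inner_mul h).inner_mul m).const_mul (-2)).add
      (hφ.bracketInv_mul.const_mul (inner ℝ m h))).add (ih.inner_mul m) using 2 with x
    rw [((hasFDerivAt_inner_mul_bracketInv m x).fun_mul (hφ.differentiable x).hasFDerivAt).fderiv]
    simp [real_inner_comm]
    ring
  | add hφ hψ ih₁ ih₂ =>
    convert! ih₁.add ih₂ using 2 with x
    rw [fderiv_fun_add (hφ.differentiable x) (hψ.differentiable x)]
    rfl
  | const_mul c hφ ih =>
    convert! ih.const_mul c using 2 with x
    rw [fderiv_const_mul (hφ.differentiable x)]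
    rfl

theorem bracketInv_nonneg (x : EuclideanSpace ℝ (Fin n)) : 0 ≤ bracketInv x := by
  unfold bracketInv; positivity

theorem bracketInv_le_one (x : EuclideanSpace ℝ (Fin n)) : bracketInv x ≤ 1 :=
  inv_le_one_of_one_le₀ (by nlinarith [norm_nonneg x])

theorem norm_mul_bracketInv_le_one (x : EuclideanSpace ℝ (Fin n)) : ‖x‖ * bracketInv x ≤ 1 := by
  rw [bracketInv, ← div_eq_mul_inv, div_le_one (by positivity)]
  nlinarith [sq_nonneg (‖x‖ - 1), sq_nonneg ‖x‖]

theorem abs_inner_mul_bracketInv_le (m x : EuclideanSpace ℝ (Fin n)) :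
    |inner ℝ m x * bracketInv x| ≤ ‖m‖ := by
  rw [abs_mul, abs_of_nonneg (bracketInv_nonneg x)]
  calc _ ≤ ‖m‖ * ‖x‖ * bracketInv x := by
        gcongr
        · exact bracketInv_nonneg x
        · exact abs_real_inner_le_norm m x
    _ = ‖m‖ * (‖x‖ * bracketInv x) := by ring
    _ ≤ ‖m‖ := mul_le_of_le_one_right (norm_nonneg m) (norm_mul_bracketInv_le_one x)

theorem IsWeight.isDominated {φ : EuclideanSpace ℝ (Fin n) → ℝ} (hφ : IsWeight φ) :
    IsDominated φ := by
  refine ⟨hφ.differentiable.continuous, ?_⟩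
  induction hφ with
  | base => exact ⟨1, fun x => by rw [one_mul, abs_of_pos (weight_pos x)]⟩
  | bracketInv_mul _ ih =>
    obtain ⟨K, hK⟩ := ih
    refine ⟨K, fun x => ?_⟩
    rw [abs_mul, abs_of_nonneg (bracketInv_nonneg x)]
    exact (mul_le_of_le_one_left (abs_nonneg _) (bracketInv_le_one x)).trans (hK x)
  | inner_mul m _ ih =>
    obtain ⟨K, hK⟩ := ih
    refine ⟨‖m‖ * K, fun x => ?_⟩
    rw [abs_mul, mul_assoc ‖m‖]
    gcongr
    · exact abs_inner_mul_bracketInv_le m x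
    · exact hK x
  | add _ _ ih₁ ih₂ =>
    obtain ⟨K₁, hK₁⟩ := ih₁
    obtain ⟨K₂, hK₂⟩ := ih₂
    refine ⟨K₁ + K₂, fun x => ?_⟩
    rw [add_mul]
    exact (abs_add_le _ _).trans (add_le_add (hK₁ x) (hK₂ x))
  | const_mul c _ ih =>
    obtain ⟨K, hK⟩ := ih
    refine ⟨|c| * K, fun x => ?_⟩
    rw [abs_mul, mul_assoc]
    gcongr
    exact hK x

/-- The second derivative of a weight is again a weight, hence dominated, and `weight_add_le`
compares its bound along the segment with that at `x`. -/
theorem IsWeight.exists_taylor_le {φ : EuclideanSpace ℝ (Fin n) → ℝ} (hφ : IsWeight φ)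
    (m : EuclideanSpace ℝ (Fin n)) (hm : ‖m‖ ≤ 1) :
    ∃ K, ∀ t : ℝ, |t| ≤ 1 → ∀ x,
      |φ (x + t • m) - φ x - t * _root_.fderiv ℝ φ x m| ≤ K * t ^ 2 * weight x := by
  obtain ⟨K, hK⟩ := ((hφ.fderiv m).fderiv m).isDominated.exists_le
  have hK0 : 0 ≤ K := nonneg_of_mul_nonneg_left ((abs_nonneg _).trans (hK 0)) (weight_pos 0)
  refine ⟨K * 3 ^ (n + 1), fun t ht x => ?_⟩
  have hd : ∀ {ψ : EuclideanSpace ℝ (Fin n) → ℝ}, IsWeight ψ → ∀ s : ℝ,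
      HasDerivAt (fun s : ℝ => ψ (x + s • t • m)) (t * _root_.fderiv ℝ ψ (x + s • t • m) m) s := by
    intro ψ hψ s
    have h1 : HasDerivAt (fun s : ℝ => x + s • t • m) (t • m) s := by
      simpa using ((hasDerivAt_id s).smul_const (t • m)).const_add x
    have h2 := (hψ.differentiable (x + s • t • m)).hasFDerivAt.comp_hasDerivAt s h1
    rw [map_smul] at h2
    exact h2
  have hb := norm_sub_sub_le_of_norm_deriv_two_le (B := K * 3 ^ (n + 1) * t ^ 2 * weight x)
    (hd hφ) (fun s => (hd (hφ.fderiv m) s).const_mul t) (fun s hs => by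
      have hst : ‖s • t • m‖ ≤ 1 := by
        rw [norm_smul, norm_smul, Real.norm_of_nonneg hs.1]
        exact mul_le_one₀ hs.2 (by positivity) (mul_le_one₀ ht (norm_nonneg _) hm)
      rw [← mul_assoc, ← sq, norm_mul, Real.norm_of_nonneg (sq_nonneg t), Real.norm_eq_abs]
      calc _ ≤ t ^ 2 * (K * (3 ^ (n + 1) * weight x)) := by
            gcongr
            refine (hK _).trans ?_
            gcongr
            exact weight_add_le x _ hst
        _ = _ := by ring)
  simpa using hb

/-! ### The transform of a vector -/

/-- The function `b ↦ ∫ φ(x) e^{i⟨b, x⟩} u(x) dx`, extended from Schwartz functions to `E n C`. -/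
def transform {φ : EuclideanSpace ℝ (Fin n) → ℝ} (hφ : IsDominated φ) (u : E n C)
    (b : EuclideanSpace ℝ (Fin n)) : C :=
  functional C φ hφ (orbit u (0, b))

theorem norm_transform_le {φ : EuclideanSpace ℝ (Fin n) → ℝ} (hφ : IsDominated φ) (u : E n C)
    (b : EuclideanSpace ℝ (Fin n)) : ‖transform hφ u b‖ ≤ ‖functional C φ hφ‖ * ‖u‖ := by
  refine (ContinuousLinearMap.le_opNorm _ _).trans_eq ?_
  rw [orbit, LinearIsometryEquiv.norm_map]

/-- For Schwartz `u`, substituting `x + t m` for `x` moves the translation onto `φ` and produces the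
phase; then `φ` is Taylor expanded. The bound is closed in `u`, so it extends by density. -/
theorem IsWeight.exists_norm_translation_le {φ : EuclideanSpace ℝ (Fin n) → ℝ} (hφ : IsWeight φ)
    (m : EuclideanSpace ℝ (Fin n)) (hm : ‖m‖ ≤ 1) :
    ∃ K, ∀ t : ℝ, |t| ≤ 1 → ∀ (u : E n C) (b : EuclideanSpace ℝ (Fin n)),
      ‖functional C φ hφ.isDominated (orbit u (t • m, b)) -
        Complex.exp ((t * inner ℝ b m : ℝ) * Complex.I) •
          (transform hφ.isDominated u b + t • transform (hφ.fderiv m).isDominated u b)‖ ≤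
        K * t ^ 2 * ‖u‖ := by
  obtain ⟨K, hK⟩ := hφ.exists_taylor_le m hm
  refine ⟨K * weightNorm n, fun t ht u b => ?_⟩
  have hcont : ∀ a : EuclideanSpace ℝ (Fin n), Continuous fun u : E n C => orbit u (a, b) :=
    fun a => continuous_U a b 0
  have hcl : IsClosed {u : E n C | ‖functional C φ hφ.isDominated (orbit u (t • m, b)) -
        Complex.exp ((t * inner ℝ b m : ℝ) * Complex.I) •
          (transform hφ.isDominated u b + t • transform (hφ.fderiv m).isDominated u b)‖ ≤
        K * weightNorm n * t ^ 2 * ‖u‖} := by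
    refine isClosed_le (Continuous.norm (Continuous.sub ?_ (Continuous.fun_const_smul
      (Continuous.add ?_ (Continuous.fun_const_smul ?_ _)) _)))
      (continuous_const.mul continuous_norm)
    · exact (functional C φ hφ.isDominated).continuous.comp (hcont _)
    · exact (functional C φ hφ.isDominated).continuous.comp (hcont _)
    · exact (functional C _ (hφ.fderiv m).isDominated).continuous.comp (hcont _)
  refine denseRange_ofSchwartz.induction_on (p := fun u => ‖functional C φ hφ.isDominated
    (orbit u (t • m, b)) - Complex.exp ((t * inner ℝ b m : ℝ) * Complex.I) •
      (transform hφ.isDominated u b + t • transform (hφ.fderiv m).isDominated u b)‖ ≤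
        K * weightNorm n * t ^ 2 * ‖u‖) u hcl fun f => ?_
  set g := schwartzU 0 b 0 f with hg
  have hg' : ‖ofSchwartz g‖ = ‖ofSchwartz f‖ := by
    rw [hg, ← U_ofSchwartz, LinearIsometryEquiv.norm_map]
  set ρ : EuclideanSpace ℝ (Fin n) → ℝ :=
    fun x => φ (x + t • m) - φ x - t * _root_.fderiv ℝ φ x m with hρ
  have hφc : Continuous φ := hφ.isDominated.continuous
  have hρc : Continuous ρ :=
    ((hφc.comp (continuous_id.add continuous_const)).sub hφc).sub
      (continuous_const.mul (hφ.fderiv m).isDominated.continuous)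
  obtain ⟨K₀, hK₀⟩ := hφ.isDominated.exists_le
  obtain ⟨K₁, hK₁⟩ := (hφ.fderiv m).isDominated.exists_le
  have i0 := integrable_smul_schwartz hφc hK₀ g
  have i1 := integrable_smul_schwartz (hφ.fderiv m).isDominated.continuous hK₁ g
  have i2 := integrable_smul_schwartz hρc (hK t ht) g
  have e : functional C φ hφ.isDominated (orbit (ofSchwartz f) (t • m, b)) =
      Complex.exp ((t * inner ℝ b m : ℝ) * Complex.I) • ∫ x, φ (x + t • m) • g x := by
    rw [orbit, U_ofSchwartz, functional_ofSchwartz, ← integral_smul,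
      ← integral_add_right_eq_self (μ := volume) _ (t • m)]
    refine integral_congr_ae (Filter.Eventually.of_forall fun x => ?_)
    dsimp only
    rw [hg, schwartzU_apply, schwartzU_apply]
    simp only [Complex.ofReal_zero, zero_mul, Complex.exp_zero, one_smul, add_sub_cancel_right,
      sub_zero, inner_add_right, inner_smul_right]
    rw [smul_comm (Complex.exp ((t * inner ℝ b m : ℝ) * Complex.I)) (φ (x + t • m)),
      smul_smul (Complex.exp ((t * inner ℝ b m : ℝ) * Complex.I)), ← Complex.exp_add]
    congr 3
    push_cast
    ring
  have e2 : ∫ x, φ (x + t • m) • g x = (∫ x, ρ x • g x) + ((∫ x, φ x • g x) +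
      t • ∫ x, _root_.fderiv ℝ φ x m • g x) := by
    have i3 : Integrable fun x => t • _root_.fderiv ℝ φ x m • g x := i1.smul t
    rw [← integral_smul, ← integral_add i0 i3, ← integral_add i2 (by exact i0.add i3)]
    refine integral_congr_ae (Filter.Eventually.of_forall fun x => ?_)
    simp only [hρ, sub_smul, mul_smul]
    abel
  rw [e, e2, transform, transform, orbit, U_ofSchwartz, ← hg, functional_ofSchwartz,
    functional_ofSchwartz, smul_add, add_sub_cancel_right, norm_smul,
    Complex.norm_exp_ofReal_mul_I, one_mul, ← hg']
  exact (norm_integral_smul_le hρc (hK t ht) g).trans_eq (by ring)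

/-- Integration by parts without functions: `t ↦ ∫ φ U_{tm,b} u` is differentiated at `0` once
through the smooth orbit and once through `IsWeight.exists_norm_translation_le`, and the two
derivatives agree. -/
theorem IsWeight.inner_smul_transform {φ : EuclideanSpace ℝ (Fin n) → ℝ} (hφ : IsWeight φ)
    (m : EuclideanSpace ℝ (Fin n)) (hm : ‖m‖ ≤ 1) {u : E n C} (hu : IsSmoothVector u)
    (b : EuclideanSpace ℝ (Fin n)) :
    ((inner ℝ b m : ℝ) * Complex.I) • transform hφ.isDominated u b =
      transform hφ.isDominated (_root_.fderiv ℝ (orbit u) 0 (m, 0)) b -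
        transform (hφ.fderiv m).isDominated u b := by
  have hd : Differentiable ℝ (orbit u) := hu.differentiable (by simp)
  obtain ⟨K, hK⟩ := hφ.exists_norm_translation_le (C := C) m hm
  have hline : HasDerivAt (fun t : ℝ => (t • m, b)) (m, (0 : EuclideanSpace ℝ (Fin n))) 0 := by
    refine HasDerivAt.prodMk ?_ (hasDerivAt_const _ _)
    simpa using (hasDerivAt_id (0 : ℝ)).smul_const m
  have h1 : HasDerivAt (fun t : ℝ => functional C φ hφ.isDominated (orbit u (t • m, b)))
      (transform hφ.isDominated (_root_.fderiv ℝ (orbit u) 0 (m, 0)) b) 0 := by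
    have h2 := (hd ((0 : ℝ) • m, b)).hasFDerivAt.comp_hasDerivAt (0 : ℝ) hline
    have h3 := ((functional C φ hφ.isDominated).restrictScalars ℝ).hasFDerivAt.comp_hasDerivAt
      (0 : ℝ) h2
    convert! h3 using 1
    rw [zero_smul]
    change _ = functional C φ hφ.isDominated (_root_.fderiv ℝ (orbit u) (0, b) (m, 0))
    rw [fderiv_orbit (hd 0) (0, b)]
    simp [transform]
  have hexp : HasDerivAt (fun t : ℝ => Complex.exp ((t * inner ℝ b m : ℝ) * Complex.I))
      ((inner ℝ b m : ℝ) * Complex.I) 0 := by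
    have h2 : HasDerivAt (fun t : ℝ => ((t * inner ℝ b m : ℝ) : ℂ) * Complex.I)
        ((1 * inner ℝ b m : ℝ) * Complex.I) 0 :=
      (((hasDerivAt_id (0 : ℝ)).mul_const _).ofReal_comp).mul_const Complex.I
    convert h2.cexp using 1
    simp
  have h4 : HasDerivAt (fun t : ℝ => Complex.exp ((t * inner ℝ b m : ℝ) * Complex.I) •
      (transform hφ.isDominated u b + t • transform (hφ.fderiv m).isDominated u b))
      (transform (hφ.fderiv m).isDominated u b +
        ((inner ℝ b m : ℝ) * Complex.I) • transform hφ.isDominated u b) 0 := by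
    have h5 : HasDerivAt (fun t : ℝ => transform hφ.isDominated u b +
        t • transform (hφ.fderiv m).isDominated u b)
        (transform (hφ.fderiv m).isDominated u b) 0 := by
      simpa using ((hasDerivAt_id (0 : ℝ)).smul_const
        (transform (hφ.fderiv m).isDominated u b)).const_add (transform hφ.isDominated u b)
    convert! hexp.smul h5 using 1
    simp
  have hO : (fun t : ℝ => functional C φ hφ.isDominated (orbit u (t • m, b)) -
      Complex.exp ((t * inner ℝ b m : ℝ) * Complex.I) •
        (transform hφ.isDominated u b + t • transform (hφ.fderiv m).isDominated u b))
      =O[nhds 0] fun t : ℝ => ‖t - 0‖ ^ 2 := by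
    refine Asymptotics.IsBigO.of_bound (K * ‖u‖) ?_
    filter_upwards [Metric.closedBall_mem_nhds (0 : ℝ) one_pos] with t ht
    rw [mem_closedBall_zero_iff] at ht
    refine (hK t ht u b).trans_eq ?_
    simp
    ring
  have h6 := (hO.hasFDerivAt (by norm_num)).hasDerivAt.add h4
  have h7 := h1.unique (h6.congr_of_eventuallyEq (Filter.Eventually.of_forall fun t => by
    simp only [Pi.add_apply, sub_add_cancel]))
  rw [h7]
  simp

/-! ### The transform of a smooth vector is a Schwartz function -/

/-- At the base points `(0, b)` the phase term of `fderiv_orbit` vanishes. -/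
theorem hasFDerivAt_transform {φ : EuclideanSpace ℝ (Fin n) → ℝ} (hφ : IsDominated φ) {u : E n C}
    (hu : IsSmoothVector u) (b : EuclideanSpace ℝ (Fin n)) :
    ∃ L : EuclideanSpace ℝ (Fin n) →L[ℝ] C, HasFDerivAt (transform hφ u) L b ∧
      ∀ k, L k = transform hφ (fderiv ℝ (orbit u) 0 (0, k)) b := by
  have hd : Differentiable ℝ (orbit u) := hu.differentiable (by simp)
  refine ⟨_, ((functional C φ hφ).restrictScalars ℝ).hasFDerivAt.comp b
    ((hd (0, b)).hasFDerivAt.comp b ((hasFDerivAt_const 0 b).prodMk (hasFDerivAt_id b))),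
    fun k => ?_⟩
  change functional C φ hφ (fderiv ℝ (orbit u) (0, b) (0, k)) = _
  rw [fderiv_orbit (hd 0) (0, b), transform]
  simp

theorem contDiff_transform {φ : EuclideanSpace ℝ (Fin n) → ℝ} (hφ : IsDominated φ) {u : E n C}
    (hu : IsSmoothVector u) : ContDiff ℝ ∞ (transform hφ u) :=
  ((functional C φ hφ).restrictScalars ℝ).contDiff.comp
    (hu.comp (contDiff_const.prodMk contDiff_id))

theorem norm_le_sum_abs_inner (b : EuclideanSpace ℝ (Fin n)) :
    ‖b‖ ≤ ∑ j, |inner ℝ b (EuclideanSpace.basisFun (Fin n) ℝ j)| := by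
  conv_lhs => rw [← (EuclideanSpace.basisFun (Fin n) ℝ).sum_repr' b]
  refine (norm_sum_le _ _).trans (Finset.sum_le_sum fun j _ => ?_)
  rw [norm_smul, OrthonormalBasis.norm_eq_one, mul_one, real_inner_comm, Real.norm_eq_abs]

/-- Each factor `‖b‖` is bounded by the sum of the `|⟨b, e_j⟩|`, and `IsWeight.inner_smul_transform`
absorbs these by changing `u` or `φ`; hence the induction runs over both. -/
theorem IsWeight.exists_pow_mul_norm_transform_le {φ : EuclideanSpace ℝ (Fin n) → ℝ}
    (hφ : IsWeight φ) {u : E n C} (hu : IsSmoothVector u) (k : ℕ) :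
    ∃ K, ∀ b, ‖b‖ ^ k * ‖transform hφ.isDominated u b‖ ≤ K := by
  induction k generalizing φ u with
  | zero => exact ⟨_, fun b => by simpa using norm_transform_le hφ.isDominated u b⟩
  | succ k ih =>
    choose K₁ hK₁ using fun j => ih hφ (hu.fderiv (EuclideanSpace.basisFun (Fin n) ℝ j, 0))
    choose K₂ hK₂ using fun j => ih (hφ.fderiv (EuclideanSpace.basisFun (Fin n) ℝ j)) hu
    refine ⟨∑ j, (K₁ j + K₂ j), fun b => ?_⟩
    calc ‖b‖ ^ (k + 1) * ‖transform hφ.isDominated u b‖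
        = ‖b‖ * (‖b‖ ^ k * ‖transform hφ.isDominated u b‖) := by ring
      _ ≤ (∑ j, |inner ℝ b (EuclideanSpace.basisFun (Fin n) ℝ j)|) *
          (‖b‖ ^ k * ‖transform hφ.isDominated u b‖) := by
          gcongr; exact norm_le_sum_abs_inner b
      _ = ∑ j, ‖b‖ ^ k * (|inner ℝ b (EuclideanSpace.basisFun (Fin n) ℝ j)| *
          ‖transform hφ.isDominated u b‖) := by
          rw [Finset.sum_mul]
          exact Finset.sum_congr rfl fun j _ => by ring
      _ ≤ ∑ j, (K₁ j + K₂ j) := by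
          refine Finset.sum_le_sum fun j _ => ?_
          have h := hφ.inner_smul_transform (EuclideanSpace.basisFun (Fin n) ℝ j)
            (OrthonormalBasis.norm_eq_one _ _).le hu b
          have h2 : |inner ℝ b (EuclideanSpace.basisFun (Fin n) ℝ j)| *
              ‖transform hφ.isDominated u b‖ =
              ‖((inner ℝ b (EuclideanSpace.basisFun (Fin n) ℝ j) : ℝ)
                * Complex.I) • transform hφ.isDominated u b‖ := by
            rw [norm_smul, norm_mul, Complex.norm_I, mul_one, Complex.norm_real, Real.norm_eq_abs]
          rw [h2, h]
          refine le_trans ?_ (add_le_add (hK₁ j b) (hK₂ j b))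
          rw [← mul_add]
          gcongr
          exact norm_sub_le _ _

/-- Writing the derivative as a finite sum of fixed linear maps applied to transforms lets bounds on
higher derivatives be obtained by induction. -/
theorem fderiv_transform {φ : EuclideanSpace ℝ (Fin n) → ℝ} (hφ : IsDominated φ) {u : E n C}
    (hu : IsSmoothVector u) : fderiv ℝ (transform hφ u) = fun b =>
      ∑ j, ContinuousLinearMap.smulRightL ℝ (EuclideanSpace ℝ (Fin n)) C
        (innerSL ℝ (EuclideanSpace.basisFun (Fin n) ℝ j))
        (transform hφ (fderiv ℝ (orbit u) 0 (0, EuclideanSpace.basisFun (Fin n) ℝ j)) b) := by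
  funext b
  obtain ⟨L, h1, h2⟩ := hasFDerivAt_transform hφ hu b
  rw [h1.fderiv]
  ext k
  conv_lhs => rw [← (EuclideanSpace.basisFun (Fin n) ℝ).sum_repr' k]
  rw [map_sum, _root_.sum_apply]
  refine Finset.sum_congr rfl fun j _ => ?_
  rw [map_smul, h2]
  rfl

theorem IsWeight.exists_pow_mul_norm_iteratedFDeriv_transform_le
    {φ : EuclideanSpace ℝ (Fin n) → ℝ} (hφ : IsWeight φ) {u : E n C} (hu : IsSmoothVector u)
    (k l : ℕ) :
    ∃ K, ∀ b, ‖b‖ ^ k * ‖iteratedFDeriv ℝ l (transform hφ.isDominated u) b‖ ≤ K := by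
  induction l generalizing u with
  | zero => simpa using hφ.exists_pow_mul_norm_transform_le hu k
  | succ l ih =>
    choose K hK using fun j => ih (hu.fderiv (0, EuclideanSpace.basisFun (Fin n) ℝ j))
    let S := fun j => ContinuousLinearMap.smulRightL ℝ (EuclideanSpace ℝ (Fin n)) C
      (innerSL ℝ (EuclideanSpace.basisFun (Fin n) ℝ j))
    have hc := fun j => contDiff_transform hφ.isDominated
      (hu.fderiv (0, EuclideanSpace.basisFun (Fin n) ℝ j))
    refine ⟨∑ j, ‖S j‖ * K j, fun b => ?_⟩
    have hl : ((l : ℕ∞) : WithTop ℕ∞) ≤ ∞ := by exact_mod_cast le_top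
    have e : _root_.fderiv ℝ (transform hφ.isDominated u) = fun b => ∑ j, (S j ∘ transform
      hφ.isDominated (_root_.fderiv ℝ (orbit u) 0 (0, EuclideanSpace.basisFun (Fin n) ℝ j))) b :=
      fderiv_transform hφ.isDominated hu
    rw [← norm_iteratedFDeriv_fderiv, e, iteratedFDeriv_fun_sum_apply fun j _ =>
        (((S j).contDiff.comp (hc j)).of_le hl).contDiffAt]
    calc _ ≤ ‖b‖ ^ k * ∑ j, ‖S j‖ * ‖iteratedFDeriv ℝ l (transform hφ.isDominated
          (_root_.fderiv ℝ (orbit u) 0 (0, EuclideanSpace.basisFun (Fin n) ℝ j))) b‖ := by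
          gcongr
          refine (norm_sum_le _ _).trans (Finset.sum_le_sum fun j _ => ?_)
          exact (S j).norm_iteratedFDeriv_comp_left ((hc j).of_le hl).contDiffAt le_rfl
      _ = ∑ j, ‖S j‖ * (‖b‖ ^ k * ‖iteratedFDeriv ℝ l (transform hφ.isDominated
          (_root_.fderiv ℝ (orbit u) 0 (0, EuclideanSpace.basisFun (Fin n) ℝ j))) b‖) := by
          rw [Finset.mul_sum]
          exact Finset.sum_congr rfl fun j _ => by ring
      _ ≤ _ := by
          gcongr with j
          exact hK j b

/-- The transform of a smooth vector, as a Schwartz function. -/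
def schwartzTransform {φ : EuclideanSpace ℝ (Fin n) → ℝ} (hφ : IsWeight φ) {u : E n C}
    (hu : IsSmoothVector u) : 𝓢(EuclideanSpace ℝ (Fin n), C) where
  toFun := transform hφ.isDominated u
  smooth' := contDiff_transform hφ.isDominated hu
  decay' := hφ.exists_pow_mul_norm_iteratedFDeriv_transform_le hu

/-! ### Smooth vectors are Schwartz functions -/

theorem isDominated_weight : IsDominated (weight : EuclideanSpace ℝ (Fin n) → ℝ) :=
  IsWeight.base.isDominated

/-- At frequency `2πξ` the character is the kernel `e^{2πi⟨ξ, x⟩}` of the inverse Fourier transform.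
-/
theorem transform_ofSchwartz (f : 𝓢(EuclideanSpace ℝ (Fin n), C))
    (ξ : EuclideanSpace ℝ (Fin n)) :
    transform isDominated_weight (ofSchwartz f) ((2 * Real.pi) • ξ) =
      𝓕⁻ (SchwartzMap.smulLeftCLM C weight f) ξ := by
  rw [transform, orbit, U_ofSchwartz, functional_ofSchwartz, SchwartzMap.fourierInv_coe,
    Real.fourierInv_eq']
  refine integral_congr_ae (Filter.Eventually.of_forall fun x => ?_)
  simp only [schwartzU_apply, SchwartzMap.smulLeftCLM_apply_apply hasTemperateGrowth_weight,
    Complex.ofReal_zero, zero_mul, Complex.exp_zero, one_smul, sub_zero, inner_smul_left]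
  rw [smul_comm, real_inner_comm]
  simp

theorem transform_sub {φ : EuclideanSpace ℝ (Fin n) → ℝ} (hφ : IsDominated φ) (u v : E n C)
    (b : EuclideanSpace ℝ (Fin n)) :
    transform hφ (u - v) b = transform hφ u b - transform hφ v b := by
  simp only [transform, orbit, map_sub]

/-- Plancherel applied to `h^* f = (w⁻¹ h)^* (w f)`. -/
theorem inner_ofSchwartz_eq_integral_transform (h f : 𝓢(EuclideanSpace ℝ (Fin n), C)) :
    (inner C (ofSchwartz h) (ofSchwartz f) : C) =
      ∫ ξ, star (𝓕⁻ (SchwartzMap.smulLeftCLM C (fun x => (weight x)⁻¹) h) ξ) *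
        transform isDominated_weight (ofSchwartz f) ((2 * Real.pi) • ξ) := by
  have key := SchwartzMap.integral_sesq_fourier_eq
    (𝓕⁻ (SchwartzMap.smulLeftCLM C (fun x => (weight x)⁻¹) h)) (SchwartzMap.smulLeftCLM C weight f)
    ((ContinuousLinearMap.mul ℂ C).comp ((starL ℂ : C ≃L⋆[ℂ] C) : C →L⋆[ℂ] C))
  rw [FourierTransform.fourier_fourierInv_eq] at key
  simp only [transform_ofSchwartz]
  refine Eq.trans ?_ key
  rw [inner_ofSchwartz]
  refine integral_congr_ae (Filter.Eventually.of_forall fun x => ?_)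
  have hx := (weight_pos x).ne'
  simp [SchwartzMap.smulLeftCLM_apply_apply hasTemperateGrowth_weight,
    SchwartzMap.smulLeftCLM_apply_apply hasTemperateGrowth_weight_inv, smul_smul, hx]

theorem norm_eq_sqrt_norm_inner_self (v : E n C) : ‖v‖ = √‖(inner C v v : C)‖ := by
  refine denseRange_ofSchwartz.induction_on v (isClosed_eq continuous_norm
    (continuous_inner_E.comp (continuous_id.prodMk continuous_id)).norm.sqrt) fun f => ?_
  rw [norm_ofSchwartz, inner_ofSchwartz]

theorem eq_zero_of_transform_eq_zero {v : E n C}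
    (hv : ∀ b, transform isDominated_weight v b = 0) : v = 0 := by
  have h1 : ∀ h : 𝓢(EuclideanSpace ℝ (Fin n), C), (inner C (ofSchwartz h) v : C) = 0 := by
    intro h
    set k := 𝓕⁻ (SchwartzMap.smulLeftCLM C (fun x => (weight x)⁻¹) h) with hk
    set L := ‖functional C (weight : EuclideanSpace ℝ (Fin n) → ℝ) isDominated_weight‖
    -- The Plancherel formula is available only for Schwartz `f`. As the transform of `v` vanishes,
    -- that of `f` equals that of `f - v`; the resulting bound extends to all `u` by density and is
    -- used at `u = v`.
    have hb : ∀ u : E n C, ‖(inner C (ofSchwartz h) u : C)‖ ≤ (∫ ξ, ‖k ξ‖) * (L * ‖u - v‖) := by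
      intro u
      refine denseRange_ofSchwartz.induction_on u (isClosed_le
        (continuous_inner_E.comp (continuous_const.prodMk continuous_id)).norm
        (by fun_prop)) fun f => ?_
      rw [inner_ofSchwartz_eq_integral_transform, ← integral_mul_const]
      refine norm_integral_le_of_norm_le (k.integrable.norm.mul_const _)
        (Filter.Eventually.of_forall fun ξ => ?_)
      refine (norm_mul_le _ _).trans ?_
      rw [norm_star]
      gcongr
      have e : transform isDominated_weight (ofSchwartz f) ((2 * Real.pi) • ξ) =
          transform isDominated_weight (ofSchwartz f - v) ((2 * Real.pi) • ξ) := by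
        rw [transform_sub, hv, sub_zero]
      rw [e]
      exact norm_transform_le _ _ _
    simpa using hb v
  have h2 : (inner C v v : C) = 0 :=
    denseRange_ofSchwartz.induction_on (p := fun u => (inner C u v : C) = 0) v
      (isClosed_eq (continuous_inner_E.comp (continuous_id.prodMk continuous_const))
        continuous_const) h1
  rw [← norm_eq_zero, norm_eq_sqrt_norm_inner_self, h2, norm_zero, Real.sqrt_zero]

theorem IsSmoothVector.exists_eq_ofSchwartz {u : E n C} (hu : IsSmoothVector u) :
    ∃ g : 𝓢(EuclideanSpace ℝ (Fin n), C), u = ofSchwartz g := by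
  have hpi : (2 * Real.pi) ≠ 0 := by positivity
  let S : EuclideanSpace ℝ (Fin n) ≃L[ℝ] EuclideanSpace ℝ (Fin n) :=
    ContinuousLinearEquiv.smulLeft (Units.mk0 (2 * Real.pi) hpi)
  let H : 𝓢(EuclideanSpace ℝ (Fin n), C) :=
    SchwartzMap.compCLMOfContinuousLinearEquiv ℝ S (schwartzTransform IsWeight.base hu)
  have hH : ∀ ξ, H ξ = transform isDominated_weight u ((2 * Real.pi) • ξ) := fun ξ => rfl
  -- `transform_ofSchwartz` forces this choice: `H` has to be the inverse Fourier transform of `w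
  -- g`.
  let g := SchwartzMap.smulLeftCLM C (fun x => (weight x)⁻¹) (𝓕 H)
  have hg : SchwartzMap.smulLeftCLM C weight g = 𝓕 H := by
    ext x
    have hx := (weight_pos x).ne'
    simp [g, SchwartzMap.smulLeftCLM_apply_apply hasTemperateGrowth_weight,
      SchwartzMap.smulLeftCLM_apply_apply hasTemperateGrowth_weight_inv, smul_smul, hx]
  refine ⟨g, sub_eq_zero.1 (eq_zero_of_transform_eq_zero fun b => ?_)⟩
  have hb : b = (2 * Real.pi) • ((2 * Real.pi)⁻¹ • b) := by
    rw [smul_smul, mul_inv_cancel₀ hpi, one_smul]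
  rw [hb, transform_sub, transform_ofSchwartz, hg, FourierTransform.fourierInv_fourier_eq, hH,
    sub_self]

end

end HeisenbergModule


theorem theorem2p3 (n : ℕ) {C : Type*} [CStarAlgebra C]
    (A : HeisenbergModule.E n C →L[ℂ] HeisenbergModule.E n C)
    (hA : HeisenbergModule.IsAdjointable A) (hs : HeisenbergModule.IsHeisenbergSmooth A)
    (f : 𝓢(EuclideanSpace ℝ (Fin n), C)) :
    ∃ g : 𝓢(EuclideanSpace ℝ (Fin n), C),
      A (HeisenbergModule.ofSchwartz f) = HeisenbergModule.ofSchwartz g :=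
  (hs.isSmoothVector_apply
    (HeisenbergModule.isSmoothVector_ofSchwartz f)).exists_eq_ofSchwartz
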